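/- Write $\lg$ for the binary logarithm and $\|\cdot\|$ for the Euclidean norm on $\mathbb R^2$. **Total acquisition number.** Let $G$ be a finite graph in which every vertex starts with weight $1$. A *total acquisition move* transfers all the (positive) weight of a vertex $u$ onto a neighbour $v$, provided that just before the move the weight on $v$ is at least the weight on $u$. A *residual set* is the set of vertices of positive weight after a sequence of moves that cannot be continued, and $a_t(G)$ is the minimum size of a residual set of $G$. **Squares.** Fix $c = 1/10000$ and $\varepsilon = 1/100$. For $n\in\mathbb N$ and $r>1$ with $r\lg r\le\sqrt n$, put $k=\lceil \sqrt n/(c\,r\lg r)\rceil$ and $x=\sqrt n/(k\,r\lg r)$, and tessellate $[0,\sqrt n]^2$ into $k^2$ *large squares* of side $x r\lg r$; put $\ell = 20\lceil x\lg r/(20c)\rceil$ and $y=x\lg r/\ell$, and tessellate each large square into $\ell^2$ *small squares* of side $yr$ (half-open, so that they are disjoint). Let $X\subset\mathbb R^2$ be a finite set of points (the vertices). A large square $\mathcal S$ is *good* for $X$ if each of its small squares contains at least $(1-\varepsilon)(yr)^2$ and at most $(1+\varepsilon)(yr)^2$ points of $X$ and, moreover, for the points of $X$ in $\mathcal S$: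 (a) none lies on the border of $\mathcal S$ or on either of its two diagonals; (b) no two lie on a line parallel to a side of $\mathcal S$; (c) no two lie on a line through the centre of $\mathcal S$. **Theorem.** There is an absolute constant $C$ such that for all $n\in\mathbb N$ and all real $r\ge C$ with $r\lg r\le\sqrt n$ the following holds. Let $X\subset\mathbb R^2$ be any finite set and $\mathcal S$ any large square (with respect to $c$, $r$, $n$) that is good for $X$ (with respect to $c,\varepsilon,r,n$), and let $G$ be the graph with vertex set $X\cap\mathcal S$ in which two distinct points $u,v$ are adjacent if and only if $\|u-v\|\le r$. Then $a_t(G)=1$. -/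

import Mathlib

noncomputable section

namespace Acquisition

/-! ### Total acquisition on a graph -/

/-- `Move G w w'`: one total acquisition move on `G`. The whole (positive) weight of some vertex `u`
is transferred to a neighbour `v`, which currently carries at least as much weight as `u`. -/
def Move {V : Type*} (G : SimpleGraph V) (w w' : V → ℕ) : Prop :=
  ∃ u v : V, G.Adj u v ∧ 0 < w u ∧ w u ≤ w v ∧
    w' u = 0 ∧ w' v = w v + w u ∧ ∀ x, x ≠ u → x ≠ v → w' x = w x

/-- `R` is a residual set of `G`: starting with weight `1` on every vertex, some finite sequence of
total acquisition moves that cannot be continued leaves positive weight exactly on `R`. -/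
def IsResidualSet {V : Type*} (G : SimpleGraph V) (R : Set V) : Prop :=
  ∃ w : V → ℕ, Relation.ReflTransGen (Move G) (fun _ => 1) w ∧ (∀ w', ¬ Move G w w') ∧
    R = {v | 0 < w v}

/-- The total acquisition number `a_t(G)`: the minimum size of a residual set. -/
def totalAcquisition {V : Type*} (G : SimpleGraph V) : ℕ∞ :=
  ⨅ R ∈ {R : Set V | IsResidualSet G R}, R.encard

/-! ### Geometric graphs -/

/-- The Euclidean plane. -/
abbrev Plane : Type := EuclideanSpace ℝ (Fin 2)

/-- The geometric graph with vertex set `X`, in which two distinct points are adjacent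
if and only if their Euclidean distance is at most `r`. -/
def geometricGraph (X : Set Plane) (r : ℝ) : SimpleGraph X where
  Adj u v := u ≠ v ∧ dist (u : Plane) (v : Plane) ≤ r
  symm := ⟨fun u v h => ⟨h.1.symm, by rw [dist_comm]; exact h.2⟩⟩
  loopless := ⟨fun _ h => h.1 rfl⟩

/-! ### The two tessellations -/

/-- The binary logarithm. -/
def lg (t : ℝ) : ℝ := Real.logb 2 t

/-- `k = ⌈√n / (c r lg r)⌉`: the square `[0,√n]²` is tessellated into `k²` large squares. -/
def numLarge (c r : ℝ) (n : ℕ) : ℕ := ⌈√(n : ℝ) / (c * r * lg r)⌉₊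

/-- `x = √n / (k r lg r)`. -/
def xRatio (c r : ℝ) (n : ℕ) : ℝ := √(n : ℝ) / (numLarge c r n * r * lg r)

/-- The side length `x r lg r` of the large squares. -/
def largeSide (c r : ℝ) (n : ℕ) : ℝ := xRatio c r n * r * lg r

/-- `ℓ = 20 ⌈x lg r / (20 c)⌉`: each large square is tessellated into `ℓ²` small squares. -/
def numSmall (c r : ℝ) (n : ℕ) : ℕ := 20 * ⌈xRatio c r n * lg r / (20 * c)⌉₊

/-- `y = x lg r / ℓ`. -/
def yRatio (c r : ℝ) (n : ℕ) : ℝ := xRatio c r n * lg r / numSmall c r n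

/-- The side length `y r` of the small squares. -/
def smallSide (c r : ℝ) (n : ℕ) : ℝ := yRatio c r n * r

/-- The large square in column `i` and row `j` (where `i, j < k`). -/
def largeSquare (c r : ℝ) (n i j : ℕ) : Set Plane :=
  {p | p 0 ∈ Set.Icc (i * largeSide c r n) ((i + 1) * largeSide c r n) ∧
       p 1 ∈ Set.Icc (j * largeSide c r n) ((j + 1) * largeSide c r n)}

/-- The small square in column `a` and row `b` (where `a, b < ℓ`) of the large square `(i, j)`.
Half-open, so that the small squares are pairwise disjoint. -/
def smallSquare (c r : ℝ) (n i j a b : ℕ) : Set Plane :=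
  {p | p 0 ∈ Set.Ico (i * largeSide c r n + a * smallSide c r n)
                     (i * largeSide c r n + (a + 1) * smallSide c r n) ∧
       p 1 ∈ Set.Ico (j * largeSide c r n + b * smallSide c r n)
                     (j * largeSide c r n + (b + 1) * smallSide c r n)}

/-- The centre of the large square `(i, j)`. -/
def largeCenter (c r : ℝ) (n i j : ℕ) : Plane :=
  !₂[(i + 1 / 2) * largeSide c r n, (j + 1 / 2) * largeSide c r n]

/-- The border (the four sides) of the large square `(i, j)`. -/
def largeBorder (c r : ℝ) (n i j : ℕ) : Set Plane :=
  {p ∈ largeSquare c r n i j |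
    p 0 = i * largeSide c r n ∨ p 0 = (i + 1) * largeSide c r n ∨
    p 1 = j * largeSide c r n ∨ p 1 = (j + 1) * largeSide c r n}

/-- The union of the two diagonals of the large square `(i, j)`. -/
def largeDiagonals (c r : ℝ) (n i j : ℕ) : Set Plane :=
  {p ∈ largeSquare c r n i j |
    p 0 - i * largeSide c r n = p 1 - j * largeSide c r n ∨
    p 0 - i * largeSide c r n = (j + 1) * largeSide c r n - p 1}

/-! ### Good squares -/

/-- The small square is good: it contains between `(1 - ε) (y r)²` and `(1 + ε) (y r)²` vertices. -/
def IsGoodSmall (c ε r : ℝ) (n : ℕ) (X : Set Plane) (i j a b : ℕ) : Prop :=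
  (1 - ε) * (yRatio c r n * r) ^ 2 ≤ ((X ∩ smallSquare c r n i j a b).ncard : ℝ) ∧
  ((X ∩ smallSquare c r n i j a b).ncard : ℝ) ≤ (1 + ε) * (yRatio c r n * r) ^ 2

/-- The large square `(i, j)` is good for the vertex set `X`. -/
structure IsGoodLarge (c ε r : ℝ) (n : ℕ) (X : Set Plane) (i j : ℕ) : Prop where
  /-- All its small squares are good. -/
  small : ∀ a < numSmall c r n, ∀ b < numSmall c r n, IsGoodSmall c ε r n X i j a b
  /-- No vertex lies on its border or on one of its two diagonals. -/
  off_border : ∀ u ∈ X ∩ largeSquare c r n i j,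
    u ∉ largeBorder c r n i j ∧ u ∉ largeDiagonals c r n i j
  /-- No two of its vertices lie on a line parallel to a side. -/
  off_parallel : ∀ u ∈ X ∩ largeSquare c r n i j, ∀ v ∈ X ∩ largeSquare c r n i j,
    u ≠ v → u 0 ≠ v 0 ∧ u 1 ≠ v 1
  /-- No two of its vertices lie on a line through its centre. -/
  off_central : ∀ u ∈ X ∩ largeSquare c r n i j, ∀ v ∈ X ∩ largeSquare c r n i j,
    u ≠ v → ¬ Collinear ℝ {largeCenter c r n i j, u, v}

end Acquisition

end

namespace Acquisition

open Finset

/-! All weight is swept towards the lower left corner of the large square. The value of `max u v`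
cuts the square into `2 ^ J` L-shaped rings of thickness of order `r`, and an angular coordinate
cuts ring `g` into `2 ^ Nat.log 2 g` sectors. The resulting blocks have diameter of order `r`, so
distinct points of one sector in the same or in consecutive rings are adjacent. By goodness each
block has between `2 ^ μ` and `2 ^ (30 + μ)` points, where `μ` is `2 lg r` up to a constant.

The obstacle is that fresh points have weight `1` and cannot receive heavier ones. The weights in
transit are therefore kept tame: at most `2 ^ (k + μ) / 2 ^ i` carriers belong to class `i`, whose
weights are at most `2 ^ i`. A clique of `2 ^ μ` fresh points takes over such carriers by a ladder
(`exists_ladder_stage`, `exists_ladder`). At stage `i` it has `2 ^ (μ - i)` active points of weight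
at least `2 ^ i`; the heavier half absorbs class `i`, and partners from the lighter half where
needed, so that it reaches `2 ^ (i + 1)`. What remains of the lighter half is again tame. Thus a hop
(`exists_hop`) preserves `k` and raises the largest class `T` by `k + 3`.

Merging two sectors raises `k` by one (`Collects.union`). As `k` is `k₀ + J - Nat.log 2 g` at ring
`g`, the total increase of `T` is linear in the number of rings (`ringCost_zero_le`). That number is
a small multiple of `lg r` because `c` is small, so `T` stays below `μ`: the ladder never runs out
of stages, and in ring `0` a single point that has pooled its block can absorb every carrier
(`Collects.finish`). -/

/-! ### Sequences of moves -/

/-- `Reaches G w w'`: some finite sequence of total acquisition moves leads from `w` to `w'`. -/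
abbrev Reaches {V : Type*} (G : SimpleGraph V) : (V → ℕ) → (V → ℕ) → Prop :=
  Relation.ReflTransGen (Move G)

/-! ### Simultaneous absorption into a disjoint set -/

section Absorb

variable {V : Type*} [DecidableEq V] {G : SimpleGraph V}

/-- Weight `0` at `u` is allowed and means no move at all, so later arguments need not track which
givers are already empty. -/
theorem reaches_transfer {w : V → ℕ} {u v : V} (h : G.Adj u v) (hw : w u ≤ w v) :
    Reaches G w (Function.update (Function.update w v (w v + w u)) u 0) := by
  rcases Nat.eq_zero_or_pos (w u) with h0 | h0
  · have : Function.update (Function.update w v (w v + w u)) u 0 = w := by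
      funext x
      by_cases hx : x = u
      · subst hx; simp [h0]
      · by_cases hx' : x = v
        · subst hx'; simp [hx, h0]
        · simp [hx, hx']
    rw [this]
  · refine Relation.ReflTransGen.single ⟨u, v, h, h0, hw, by simp, ?_, ?_⟩
    · simp [Function.update_of_ne h.ne.symm]
    · intro x hx hx'
      simp [hx, hx']

/-- All vertices of `C` simultaneously give their weight to their images under `f`. -/
def absorbed (w : V → ℕ) (C : Finset V) (f : V → V) (v : V) : ℕ :=
  if v ∈ C then 0 else w v + ∑ c ∈ C with f c = v, w c

/-- The givers act one at a time. No receiver is a giver, so receivers only gain weight and the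
comparison of the initial weights stays sufficient. -/
theorem reaches_absorbed (w : V → ℕ) (C : Finset V) (f : V → V)
    (h : ∀ c ∈ C, G.Adj c (f c) ∧ f c ∉ C ∧ w c ≤ w (f c)) :
    Reaches G w (absorbed w C f) := by
  induction C using Finset.induction_on with
  | empty =>
    have : absorbed w ∅ f = w := by funext v; simp [absorbed]
    rw [this]
  | insert a C ha ih =>
    have ih' := ih fun c hc => by
      obtain ⟨h1, h2, h3⟩ := h c (mem_insert_of_mem hc)
      exact ⟨h1, fun h' => h2 (mem_insert_of_mem h'), h3⟩
    obtain ⟨h1, h2, h3⟩ := h a (mem_insert_self a C)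
    have hfa : f a ∉ C := fun h' => h2 (mem_insert_of_mem h')
    have hno : ∀ c ∈ C, f c ≠ a := fun c hc h' =>
      (h c (mem_insert_of_mem hc)).2.1 (h' ▸ mem_insert_self _ _)
    have hwa : absorbed w C f a = w a := by
      simp only [absorbed, if_neg ha]
      rw [Finset.filter_false_of_mem hno]; simp
    have hle : absorbed w C f a ≤ absorbed w C f (f a) := by
      rw [hwa]
      simp only [absorbed, if_neg hfa]
      omega
    refine ih'.trans ?_
    convert reaches_transfer h1 hle using 1
    funext v
    rw [hwa]
    by_cases hva : v = a
    · subst hva; simp [absorbed]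
    · by_cases hvf : v = f a
      · subst hvf
        simp only [absorbed, if_neg h2, if_neg hfa, Function.update_of_ne hva, Function.update_self]
        rw [Finset.filter_insert, if_pos rfl, Finset.sum_insert (by simp [ha])]
        ring
      · simp only [Function.update_of_ne hva, Function.update_of_ne hvf, absorbed, mem_insert, hva,
          false_or]
        rw [Finset.filter_insert, if_neg (fun h' : f a = v => hvf h'.symm)]

theorem absorbed_of_mem {w : V → ℕ} {C : Finset V} {f : V → V} {v : V} (h : v ∈ C) :
    absorbed w C f v = 0 := by simp [absorbed, h]

theorem absorbed_of_notMem {w : V → ℕ} {C : Finset V} {f : V → V} {v : V} (h : v ∉ C) :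
    absorbed w C f v = w v + ∑ c ∈ C with f c = v, w c := by simp [absorbed, h]

theorem absorbed_of_forall_ne {w : V → ℕ} {C : Finset V} {f : V → V} {v : V} (h : v ∉ C)
    (hf : ∀ c ∈ C, f c ≠ v) : absorbed w C f v = w v := by
  rw [absorbed_of_notMem h, Finset.filter_false_of_mem hf]; simp

/-- A finite set contains its `n` heaviest elements. -/
theorem exists_heaviest_subset (w : V → ℕ) (P : Finset V) (n : ℕ) (hn : n ≤ #P) :
    ∃ Q ⊆ P, #Q = n ∧ ∀ p ∈ Q, ∀ q ∈ P \ Q, w q ≤ w p := by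
  induction n with
  | zero => exact ⟨∅, by simp, by simp, by simp⟩
  | succ n ih =>
    obtain ⟨Q, hQ, hc, hw⟩ := ih (by omega)
    have hne : (P \ Q).Nonempty := by
      rw [← Finset.card_pos, Finset.card_sdiff_of_subset hQ]; omega
    obtain ⟨m, hm, hmax⟩ := Finset.exists_max_image (P \ Q) w hne
    have hm' := mem_sdiff.1 hm
    refine ⟨insert m Q, insert_subset hm'.1 hQ, by rw [card_insert_of_notMem hm'.2, hc], ?_⟩
    intro p hp q hq
    have hq' : q ∈ P \ Q := by
      simp only [mem_sdiff, mem_insert, not_or] at hq ⊢; tauto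
    rcases mem_insert.1 hp with rfl | hp
    · exact hmax q hq'
    · exact hw p hp q hq'

/-- A set can be distributed over another one with bounded fibres. -/
theorem exists_map_card_fiber_le (C Q : Finset V) (n : ℕ) (h : #C ≤ n * #Q) :
    ∃ f : V → V, (∀ c ∈ C, f c ∈ Q) ∧ ∀ q, #{c ∈ C | f c = q} ≤ n := by
  have hc : Fintype.card C ≤ Fintype.card (Q × Fin n) := by
    simp only [Fintype.card_coe, Fintype.card_prod, Fintype.card_fin]
    rw [mul_comm]; exact h
  obtain ⟨φ⟩ := Function.Embedding.nonempty_of_card_le hc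
  refine ⟨fun v => if hv : v ∈ C then ((φ ⟨v, hv⟩).1 : V) else v, ?_, ?_⟩
  · intro c hc
    simp only [hc, dif_pos]
    exact (φ ⟨c, hc⟩).1.2
  · intro q
    have key : #({c ∈ C | (fun v => if hv : v ∈ C then ((φ ⟨v, hv⟩).1 : V) else v) c = q}).attach
        ≤ #(univ : Finset (Fin n)) := by
      refine Finset.card_le_card_of_injOn
        (fun x => (φ ⟨x.1, (mem_filter.1 x.2).1⟩).2) (fun _ _ => mem_coe.2 (mem_univ _)) ?_
      intro x _ y _ hxy
      have hx := (mem_filter.1 x.2).2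
      have hy := (mem_filter.1 y.2).2
      simp only [(mem_filter.1 x.2).1, (mem_filter.1 y.2).1, dif_pos] at hx hy
      have := φ.injective (Prod.ext (Subtype.ext (hx.trans hy.symm)) hxy)
      exact Subtype.ext (Subtype.mk.inj this)
    simpa using key

end Absorb

/-! ### One stage of the ladder -/

section Stage

variable {V : Type*} [DecidableEq V] {G : SimpleGraph V}

/-- The lighter half of a clique can be matched into the heavier half. -/
theorem exists_heavier_half (w : V → ℕ) {P : Finset V} {n : ℕ} (hP : #P = 2 * n) :
    ∃ Q ⊆ P, #Q = n ∧ #(P \ Q) = n ∧ ∃ f : V → V, ∀ p ∈ P \ Q, f p ∈ Q ∧ w p ≤ w (f p) ∧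
      ∀ q ∈ P \ Q, f p = f q → p = q := by
  obtain ⟨Q, hQ, hc, hw⟩ := exists_heaviest_subset w P n (by omega)
  have hc' : #(P \ Q) = n := by rw [card_sdiff_of_subset hQ]; omega
  obtain ⟨f, hf, hf'⟩ := exists_map_card_fiber_le (P \ Q) Q 1 (by omega)
  refine ⟨Q, hQ, hc, hc', f, fun p hp => ⟨hf p hp, hw _ (hf p hp) p hp, fun q hq h => ?_⟩⟩
  exact Finset.card_le_one.1 (hf' (f q)) p (by simp [h, mem_sdiff.1 hp]) q
    (by simp [mem_sdiff.1 hq])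

/-- Merging a clique pairwise. -/
theorem exists_merge_pairs (w : V → ℕ) {P : Finset V} {n U : ℕ} (hP : #P = 2 * n)
    (hadj : ∀ p ∈ P, ∀ q ∈ P, p ≠ q → G.Adj p q) (hU : ∀ p ∈ P, w p ≤ U) :
    ∃ Q ⊆ P, #Q = n ∧ ∃ w', Reaches G w w' ∧ (∀ v ∉ P, w' v = w v) ∧ (∀ v ∈ P \ Q, w' v = 0) ∧
      ∀ v ∈ Q, w' v ≤ 2 * U := by
  obtain ⟨Q, hQ, hc, hc', f, hf⟩ := exists_heavier_half w hP
  refine ⟨Q, hQ, hc, absorbed w (P \ Q) f, reaches_absorbed _ _ _ ?_, ?_, ?_, ?_⟩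
  · intro c hcm
    obtain ⟨h1, h2, -⟩ := hf c hcm
    have hcm' := mem_sdiff.1 hcm
    exact ⟨hadj _ hcm'.1 _ (hQ h1) fun h => hcm'.2 (h ▸ h1), fun h => (mem_sdiff.1 h).2 h1, h2⟩
  · intro v hv
    refine absorbed_of_forall_ne (fun h => hv (mem_sdiff.1 h).1) fun c hc h => hv ?_
    exact h ▸ hQ (hf c hc).1
  · exact fun v hv => absorbed_of_mem hv
  · intro v hv
    rw [absorbed_of_notMem fun h => (mem_sdiff.1 h).2 hv]
    have h1 : #{c ∈ P \ Q | f c = v} ≤ 1 := by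
      refine Finset.card_le_one.2 fun a ha b hb => ?_
      rw [mem_filter] at ha hb
      exact (hf a ha.1).2.2 b hb.1 (ha.2.trans hb.2.symm)
    have h2 : ∑ c ∈ P \ Q with f c = v, w c ≤ #{c ∈ P \ Q | f c = v} • U :=
      Finset.sum_le_card_nsmul _ _ _ fun c hc =>
        hU _ (mem_sdiff.1 (mem_filter.1 hc).1).1
    have h3 : #{c ∈ P \ Q | f c = v} • U ≤ 1 * U := Nat.mul_le_mul_right _ h1
    have := hU v (hQ hv)
    omega

/-- One stage of the ladder: the heavier half of a clique `P`, all of whose vertices have weight at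
least `s`, absorbs a set `C` of vertices of weight at most `s`. Those that do not reach `2 * s` by
this absorb a partner from the lighter half. -/
theorem exists_ladder_stage (w : V → ℕ) {P C : Finset V} {n N s : ℕ} (hN : 2 ≤ N)
    (hP : #P = 2 * n) (hC : #C ≤ N * n) (hPC : Disjoint P C)
    (hadj : ∀ p ∈ P ∪ C, ∀ q ∈ P, p ≠ q → G.Adj p q)
    (hlo : ∀ p ∈ P, s ≤ w p) (hhi : ∀ p ∈ P, w p ≤ N * s) (hCs : ∀ c ∈ C, w c ≤ s) :
    ∃ Q ⊆ P, #Q = n ∧ #(P \ Q) = n ∧ ∃ w', Reaches G w w' ∧ (∀ v ∉ P ∪ C, w' v = w v) ∧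
      (∀ v ∈ C, w' v = 0) ∧ (∀ v ∈ Q, 2 * s ≤ w' v ∧ w' v ≤ N * (2 * s)) ∧
      ∀ v ∈ P \ Q, w' v ≤ N * s := by
  obtain ⟨Q, hQ, hc, hc', f, hf⟩ := exists_heavier_half w hP
  obtain ⟨g, hg, hg'⟩ := exists_map_card_fiber_le C Q N (by rw [hc]; exact hC)
  have hdis : ∀ v ∈ P, v ∉ C := fun v hv hv' => Finset.disjoint_left.1 hPC hv hv'
  set D : Finset V := {p ∈ P \ Q | w (f p) + ∑ c ∈ C with g c = f p, w c < 2 * s} with hD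
  set F : V → V := fun v => if v ∈ C then g v else f v with hF
  have hDP : ∀ v ∈ D, v ∈ P \ Q := fun v hv => (mem_filter.1 hv).1
  have hFC : ∀ v ∈ C, F v = g v := fun v hv => by simp [hF, hv]
  have hFD : ∀ v ∈ D, F v = f v := fun v hv => by
    simp [hF, hdis v (mem_sdiff.1 (hDP v hv)).1]
  have hFQ : ∀ v ∈ C ∪ D, F v ∈ Q := by
    intro v hv
    rcases mem_union.1 hv with h | h
    · rw [hFC v h]; exact hg v h
    · rw [hFD v h]; exact (hf v (hDP v h)).1
  have hQn : ∀ v ∈ Q, v ∉ C ∪ D := by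
    intro v hv h
    rcases mem_union.1 h with h | h
    · exact hdis v (hQ hv) h
    · exact (mem_sdiff.1 (hDP v h)).2 hv
  have hCD : Disjoint C D := Finset.disjoint_left.2 fun v hv hv' =>
    hdis v (mem_sdiff.1 (hDP v hv')).1 hv
  refine ⟨Q, hQ, hc, hc', absorbed w (C ∪ D) F, reaches_absorbed _ _ _ ?_, ?_, ?_, ?_, ?_⟩
  · intro c hcm
    refine ⟨hadj _ ?_ _ (hQ (hFQ c hcm)) ?_, hQn _ (hFQ c hcm), ?_⟩
    · rcases mem_union.1 hcm with h | h
      · exact mem_union_right _ h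
      · exact mem_union_left _ (mem_sdiff.1 (hDP c h)).1
    · intro h
      exact hQn _ (hFQ c hcm) (h ▸ hcm)
    · rcases mem_union.1 hcm with h | h
      · exact (hCs c h).trans (hlo _ (hQ (hFQ c hcm)))
      · rw [hFD c h]; exact (hf c (hDP c h)).2.1
  · intro v hv
    refine absorbed_of_forall_ne (fun h => hv ?_) fun c hc h => hv ?_
    · rcases mem_union.1 h with h | h
      · exact mem_union_right _ h
      · exact mem_union_left _ (mem_sdiff.1 (hDP v h)).1
    · exact mem_union_left _ (h ▸ hQ (hFQ c hc))
  · exact fun v hv => absorbed_of_mem (mem_union_left _ hv)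
  · intro v hv
    have e1 : ∑ c ∈ C ∪ D with F c = v, w c
        = (∑ c ∈ C with g c = v, w c) + ∑ c ∈ D with f c = v, w c := by
      rw [filter_union, sum_union (Finset.disjoint_filter_filter hCD)]
      congr 1
      · exact Finset.sum_congr (Finset.filter_congr fun c hc => by rw [hFC c hc]) fun _ _ => rfl
      · exact Finset.sum_congr (Finset.filter_congr fun c hc => by rw [hFD c hc]) fun _ _ => rfl
    have hCv : ∑ c ∈ C with g c = v, w c ≤ N * s :=
      (Finset.sum_le_card_nsmul _ _ s fun c hc => hCs c (mem_filter.1 hc).1).trans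
        (Nat.mul_le_mul_right _ (hg' v))
    have hv1 := hhi v (hQ hv)
    have hv2 := hlo v (hQ hv)
    rw [absorbed_of_notMem (hQn v hv), e1]
    have h2N : 2 * s ≤ N * s := Nat.mul_le_mul_right _ hN
    have eN : N * (2 * s) = N * s + N * s := by ring
    -- If `v` still has less than `2 * s`, its partner adds between `s` and `N * s`, and `2 * s + N
    -- * s ≤ N * (2 * s)` because `N ≥ 2`. Otherwise `v` takes no partner, and its own weight and
    -- its carriers contribute at most `N * s` each.
    by_cases hlt : w v + ∑ c ∈ C with g c = v, w c < 2 * s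
    · obtain ⟨p, hp, hpv⟩ : ∃ p ∈ P \ Q, f p = v := by
        have := Finset.surj_on_of_inj_on_of_card_le (s := P \ Q) (t := Q) (fun a _ => f a)
          (fun a ha => (hf a ha).1) (fun a b ha hb h => (hf a ha).2.2 b hb h) (by omega) v hv
        obtain ⟨p, hp, h⟩ := this
        exact ⟨p, hp, h.symm⟩
      have hpD : p ∈ D := by rw [hD, mem_filter]; exact ⟨hp, by rw [hpv]; exact hlt⟩
      have e2 : {c ∈ D | f c = v} = {p} := by
        ext c
        simp only [mem_filter, mem_singleton]
        constructor
        · rintro ⟨h1, h2⟩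
          exact (hf c (hDP c h1)).2.2 p hp (h2.trans hpv.symm)
        · rintro rfl; exact ⟨hpD, hpv⟩
      rw [e2, sum_singleton]
      have := hlo p (mem_sdiff.1 hp).1
      have := hhi p (mem_sdiff.1 hp).1
      omega
    · have e2 : {c ∈ D | f c = v} = ∅ := by
        refine Finset.filter_false_of_mem fun c hc h => hlt ?_
        have := (mem_filter.1 hc).2
        rwa [h] at this
      rw [e2, sum_empty]
      omega
  · intro v hv
    by_cases hvD : v ∈ D
    · rw [absorbed_of_mem (mem_union_right _ hvD)]; exact Nat.zero_le _
    · have hv' := mem_sdiff.1 hv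
      rw [absorbed_of_forall_ne]
      · exact hhi v hv'.1
      · simp [hvD, hdis v hv'.1]
      · exact fun c hc h => hv'.2 (h ▸ hFQ c hc)

end Stage
-- Tame weights, the ladder and the hop onto a fresh clique
section Hop

variable {V : Type*} [DecidableEq V] {G : SimpleGraph V}

/-- The labels `lab` bound the weights on `A` and, for each label `i`, at most `M / 2 ^ i` vertices
of `A` carry it. -/
def IsTame (w : V → ℕ) (A : Finset V) (M : ℕ) (lab : V → ℕ) : Prop :=
  (∀ v ∈ A, w v ≤ 2 ^ lab v) ∧ ∀ i, 2 ^ i * #{v ∈ A | lab v = i} ≤ M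

/-- Extending a tame labelling by a set all of whose elements get the same new label. -/
theorem IsTame.extend {w w' : V → ℕ} {A R : Finset V} {M l : ℕ} {lab : V → ℕ}
    (h : IsTame w A M lab) (hl : ∀ v ∈ A, lab v < l) (hw : ∀ v ∈ A, w' v = w v)
    (hAR : Disjoint A R) (hR : ∀ v ∈ R, w' v ≤ 2 ^ l) (hM : 2 ^ l * #R ≤ M) :
    IsTame w' (A ∪ R) M (fun v => if v ∈ R then l else lab v) := by
  have hA : ∀ v ∈ A, v ∉ R := fun v hv hv' => Finset.disjoint_left.1 hAR hv hv'
  refine ⟨fun v hv => ?_, fun i => ?_⟩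
  · by_cases hvR : v ∈ R
    · simpa [hvR] using hR v hvR
    · have hvA : v ∈ A := (mem_union.1 hv).resolve_right hvR
      simpa [hvR, hw v hvA] using h.1 v hvA
  · by_cases hi : i = l
    · refine le_trans ?_ hM
      rw [hi]
      refine Nat.mul_le_mul_left _ (Finset.card_le_card fun v hv => ?_)
      rw [mem_filter] at hv
      by_contra hvR
      have hvA : v ∈ A := (mem_union.1 hv.1).resolve_right hvR
      have := hv.2
      simp only [hvR, if_false] at this
      exact absurd this (hl v hvA).ne
    · refine le_trans (Nat.mul_le_mul_left _ (Finset.card_le_card fun v hv => ?_)) (h.2 i)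
      rw [mem_filter] at hv ⊢
      have hvR : v ∉ R := fun hvR => hi (by simpa [hvR] using hv.2.symm)
      exact ⟨(mem_union.1 hv.1).resolve_right hvR, by simpa [hvR] using hv.2⟩

/-- The state of the ladder after the carriers with label less than `i` have been absorbed. -/
theorem exists_ladder (w : V → ℕ) {A B : Finset V} {lab : V → ℕ} {k μ : ℕ}
    (hA : IsTame w A (2 ^ (k + μ)) lab) (hB : #B = 2 ^ μ) (hAB : Disjoint B A)
    (hB1 : ∀ v ∈ B, w v = 1) (hadj : ∀ p ∈ B ∪ A, ∀ q ∈ B, p ≠ q → G.Adj p q)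
    (i : ℕ) (hi : i ≤ μ) :
    ∃ w', Reaches G w w' ∧ (∀ v ∉ B ∪ A, w' v = w v) ∧
      (∀ v ∈ A, lab v < i → w' v = 0) ∧ (∀ v ∈ A, i ≤ lab v → w' v = w v) ∧
      ∃ P ⊆ B, #P = 2 ^ (μ - i) ∧ (∀ v ∈ P, 2 ^ i ≤ w' v ∧ w' v ≤ 2 ^ (k + 1) * 2 ^ i) ∧
      ∃ lab' : V → ℕ, IsTame w' (B \ P) (2 ^ (k + μ)) lab' ∧
        ∀ v ∈ B \ P, k + 1 ≤ lab' v ∧ lab' v < k + 1 + i := by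
  induction i with
  | zero =>
    refine ⟨w, .refl, fun _ _ => rfl, fun _ _ h => absurd h (Nat.not_lt_zero _),
      fun _ _ _ => rfl, B, Subset.rfl, by simpa using hB, fun v hv => ?_, fun _ => 0, ?_, ?_⟩
    · rw [hB1 v hv]; exact ⟨by simp, by simpa using Nat.one_le_two_pow⟩
    · simp [IsTame]
    · simp
  | succ i ih =>
    obtain ⟨w₁, hr, hout, hlt, hge, P, hPB, hPc, hPw, lab₁, htame, hlab⟩ := ih (by omega)
    set C : Finset V := {v ∈ A | lab v = i} with hCdef
    have hCA : C ⊆ A := filter_subset _ _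
    have hPA : Disjoint P A := Finset.disjoint_of_subset_left hPB hAB
    have epow : 2 ^ (μ - i) = 2 * 2 ^ (μ - (i + 1)) := by
      rw [← pow_succ']; congr 1; omega
    -- Class `i` has at most `2 ^ (k + μ - i)` members, which is `2 ^ (k + 1)` for each point of the
    -- heavier half; hence the choice of `N` below.
    have hCcard : #C ≤ 2 ^ (k + 1) * 2 ^ (μ - (i + 1)) := by
      refine Nat.le_of_mul_le_mul_left ((hA.2 i).trans_eq ?_) (Nat.two_pow_pos i)
      rw [← pow_add, ← pow_add]; congr 1; omega
    obtain ⟨Q, hQP, hQc, hQc', w₂, hr₂, hout₂, hC₂, hQ₂, hR₂⟩ :=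
      exists_ladder_stage (G := G) w₁ (P := P) (C := C) (n := 2 ^ (μ - (i + 1)))
        (N := 2 ^ (k + 1)) (s := 2 ^ i)
        (by rw [pow_succ]; have := Nat.one_le_two_pow (n := k); omega)
        (by rw [hPc, epow]) hCcard (Finset.disjoint_of_subset_right hCA hPA)
        (fun p hp q hq => hadj p (union_subset_union hPB hCA hp) q (hPB hq))
        (fun p hp => (hPw p hp).1) (fun p hp => (hPw p hp).2)
        (fun c hc => by
          have hc' := mem_filter.1 hc
          rw [hge c hc'.1 hc'.2.ge, ← hc'.2]
          exact hA.1 c hc'.1)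
    have hBPC : ∀ v ∈ B \ P, v ∉ P ∪ C := fun v hv h => by
      have hv' := mem_sdiff.1 hv
      rcases mem_union.1 h with h | h
      · exact hv'.2 h
      · exact Finset.disjoint_left.1 hAB hv'.1 (hCA h)
    have hAC : ∀ v ∈ A, lab v ≠ i → w₂ v = w₁ v := fun v hv hne => hout₂ v fun h => by
      rcases mem_union.1 h with h | h
      · exact Finset.disjoint_left.1 hPA h hv
      · exact hne (mem_filter.1 h).2
    have hBQ : B \ Q = (B \ P) ∪ (P \ Q) := by
      ext v
      simp only [mem_sdiff, mem_union]
      have := @hPB v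
      have := @hQP v
      tauto
    refine ⟨w₂, hr.trans hr₂, fun v hv => ?_, fun v hv hvi => ?_, fun v hv hvi => ?_,
      Q, hQP.trans hPB, hQc, fun v hv => ?_,
      fun v => if v ∈ P \ Q then k + 1 + i else lab₁ v, ?_, ?_⟩
    · rw [hout₂ v fun h => hv (union_subset_union hPB hCA h), hout v hv]
    · rcases Nat.lt_succ_iff_lt_or_eq.1 hvi with h | h
      · rw [hAC v hv h.ne, hlt v hv h]
      · exact hC₂ v (mem_filter.2 ⟨hv, h⟩)
    · rw [hAC v hv (by omega), hge v hv (by omega)]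
    · rw [pow_succ']; exact hQ₂ v hv
    · rw [hBQ]
      refine htame.extend (fun v hv => (hlab v hv).2) (fun v hv => hout₂ v (hBPC v hv)) ?_ ?_ ?_
      · exact Finset.disjoint_left.2 fun v hv hv' => (mem_sdiff.1 hv).2 (mem_sdiff.1 hv').1
      · intro v hv
        rw [pow_add]; exact hR₂ v hv
      -- The lighter half has `2 ^ (μ - i - 1)` points of weight at most `2 ^ (k + 1 + i)`: the
      -- product is exactly the budget `2 ^ (k + μ)`.
      · rw [hQc', ← pow_add]
        exact Nat.pow_le_pow_right two_pos (by omega)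
    · intro v hv
      by_cases h : v ∈ P \ Q
      · simp only [h, if_true]; omega
      · rw [hBQ] at hv
        have := hlab v ((mem_union.1 hv).resolve_right h)
        simp only [h, if_false]; omega

/-- A tame set of carriers can be moved onto a clique of vertices of weight `1`, in such a way that
the result is tame again. -/
theorem exists_hop (w : V → ℕ) {A B : Finset V} {lab : V → ℕ} {k μ T : ℕ}
    (hA : IsTame w A (2 ^ (k + μ)) lab) (hT : ∀ v ∈ A, lab v ≤ T) (hTμ : T + 3 ≤ μ)
    (hB : #B = 2 ^ μ) (hAB : Disjoint B A)
    (hB1 : ∀ v ∈ B, w v = 1) (hadj : ∀ p ∈ B ∪ A, ∀ q ∈ B, p ≠ q → G.Adj p q) :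
    ∃ w', Reaches G w w' ∧ (∀ v ∉ B ∪ A, w' v = w v) ∧ (∀ v ∈ A, w' v = 0) ∧
      ∃ B₀ ⊆ B, (∀ v ∈ B \ B₀, w' v = 0) ∧ ∃ lab' : V → ℕ, IsTame w' B₀ (2 ^ (k + μ)) lab' ∧
        ∀ v ∈ B₀, 1 ≤ lab' v ∧ lab' v ≤ T + k + 3 := by
  obtain ⟨w₁, hr, hout, hlt, -, P, hPB, hPc, hPw, lab₁, htame, hlab⟩ :=
    exists_ladder w hA hB hAB hB1 hadj (T + 1) (by omega)
  -- The `2 ^ (μ - T - 1)` remaining points of weight up to `2 ^ (k + T + 2)` exceed the budget by a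
  -- factor of two. Half of them keep class `k + T + 2`; the other half is merged in pairs into
  -- class `k + T + 3`. Both classes then fill the budget exactly.
  have hP2 : 2 ^ (μ - (T + 3)) * 4 = #P := by
    rw [hPc, show (4 : ℕ) = 2 ^ 2 from rfl, ← pow_add]; congr 1; omega
  obtain ⟨P', hP'P, hP'c⟩ := Finset.exists_subset_card_eq
    (show 2 * 2 ^ (μ - (T + 3)) ≤ #P by omega)
  obtain ⟨Q, hQP', hQc, w₂, hr₂, hout₂, hzero₂, hQ₂⟩ :=
    exists_merge_pairs (G := G) w₁ (U := 2 ^ (k + 1) * 2 ^ (T + 1)) hP'c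
      (fun p hp q hq => hadj p (mem_union_left _ (hPB (hP'P hp))) q (hPB (hP'P hq)))
      (fun p hp => (hPw p (hP'P hp)).2)
  have hRc : #(P \ P') = 2 * 2 ^ (μ - (T + 3)) := by
    rw [card_sdiff_of_subset hP'P]; omega
  have hAP : ∀ v ∈ A, v ∉ P' := fun v hv h =>
    Finset.disjoint_left.1 hAB (hPB (hP'P h)) hv
  have ht₁ := htame.extend (w' := w₂) (R := P \ P') (l := k + 1 + (T + 1))
    (fun v hv => (hlab v hv).2)
    (fun v hv => hout₂ v fun h => (mem_sdiff.1 hv).2 (hP'P h))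
    (Finset.disjoint_left.2 fun v hv hv' => (mem_sdiff.1 hv).2 (mem_sdiff.1 hv').1)
    (fun v hv => by
      rw [hout₂ v (mem_sdiff.1 hv).2, pow_add]
      exact (hPw v (mem_sdiff.1 hv).1).2)
    (by
      rw [hRc, ← pow_succ', ← pow_add]
      exact Nat.pow_le_pow_right two_pos (by omega))
  have hl₁ : ∀ v ∈ B \ P ∪ P \ P',
      1 ≤ (if v ∈ P \ P' then k + 1 + (T + 1) else lab₁ v) ∧
      (if v ∈ P \ P' then k + 1 + (T + 1) else lab₁ v) < k + 1 + (T + 1) + 1 := by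
    intro v hv
    by_cases h : v ∈ P \ P'
    · simp only [h, if_true]; omega
    · have := hlab v ((mem_union.1 hv).resolve_right h)
      simp only [h, if_false]; omega
  have ht₂ := ht₁.extend (w' := w₂) (R := Q) (l := k + 1 + (T + 1) + 1)
    (fun v hv => (hl₁ v hv).2) (fun _ _ => rfl)
    (Finset.disjoint_left.2 fun v hv hv' => by
      rcases mem_union.1 hv with h | h
      · exact (mem_sdiff.1 h).2 (hP'P (hQP' hv'))
      · exact (mem_sdiff.1 h).2 (hQP' hv'))
    (fun v hv => (hQ₂ v hv).trans_eq (by ring))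
    (by
      rw [hQc, ← pow_add]
      exact Nat.pow_le_pow_right two_pos (by omega))
  refine ⟨w₂, hr.trans hr₂, fun v hv => ?_, fun v hv => ?_, _, ?_, ?_, _, ht₂, ?_⟩
  · rw [hout₂ v fun h => hv (mem_union_left _ (hPB (hP'P h))), hout v hv]
  · rw [hout₂ v (hAP v hv), hlt v hv (Nat.lt_succ_of_le (hT v hv))]
  · refine union_subset (union_subset sdiff_subset (sdiff_subset.trans hPB)) ?_
    exact hQP'.trans (hP'P.trans hPB)
  · intro v hv
    refine hzero₂ v ?_
    simp only [mem_sdiff, mem_union, not_or, not_and, not_not] at hv ⊢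
    tauto
  · intro v hv
    by_cases h : v ∈ Q
    · simp only [h, if_true]; omega
    · have := hl₁ v ((mem_union.1 hv).resolve_right h)
      simp only [h, if_false]; omega

end Hop

/-! ### Collecting weight along a tree of blocks -/

section Tree

variable {V : Type*} [DecidableEq V] {G : SimpleGraph V}

/-- Starting with weight `1` on `A`, all the weight of `A` can be moved to `B`, such that the weights
on `B` are tame with labels between `1` and `T`. -/
def Collects (G : SimpleGraph V) (μ : ℕ) (A B : Finset V) (k T : ℕ) : Prop :=
  B ⊆ A ∧ ∀ w : V → ℕ, (∀ v ∈ A, w v = 1) →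
    ∃ w', Reaches G w w' ∧ (∀ v ∉ A, w' v = w v) ∧
      ∃ B₀ ⊆ B, (∀ v ∈ A \ B₀, w' v = 0) ∧ ∃ lab : V → ℕ, IsTame w' B₀ (2 ^ (k + μ)) lab ∧
        ∀ v ∈ B₀, 1 ≤ lab v ∧ lab v ≤ T

theorem collects_empty (μ k T : ℕ) : Collects G μ ∅ ∅ k T :=
  ⟨Subset.rfl, fun w _ => ⟨w, .refl, fun _ _ => rfl, ∅, Subset.rfl, by simp, fun _ => 0,
    by simp [IsTame], by simp⟩⟩

/-- The class sizes add up, so the budget doubles, while the largest class is unchanged. -/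
theorem Collects.union {μ k T : ℕ} {A₁ B₁ A₂ B₂ : Finset V} (h₁ : Collects G μ A₁ B₁ k T)
    (h₂ : Collects G μ A₂ B₂ k T) (hd : Disjoint A₁ A₂) :
    Collects G μ (A₁ ∪ A₂) (B₁ ∪ B₂) (k + 1) T := by
  refine ⟨union_subset_union h₁.1 h₂.1, fun w hw => ?_⟩
  have hd' : ∀ v ∈ A₁, v ∉ A₂ := fun v hv hv' => Finset.disjoint_left.1 hd hv hv'
  obtain ⟨w₁, hr₁, ho₁, C₁, hC₁, hz₁, l₁, ht₁, hl₁⟩ :=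
    h₁.2 w fun v hv => hw v (mem_union_left _ hv)
  obtain ⟨w₂, hr₂, ho₂, C₂, hC₂, hz₂, l₂, ht₂, hl₂⟩ := h₂.2 w₁ fun v hv => by
    rw [ho₁ v fun h => hd' v h hv]; exact hw v (mem_union_right _ hv)
  have hC₁A : ∀ v ∈ C₁, v ∈ A₁ := fun v hv => h₁.1 (hC₁ hv)
  have hC₂A : ∀ v ∈ C₂, v ∉ A₁ := fun v hv h => hd' v h (h₂.1 (hC₂ hv))
  refine ⟨w₂, hr₁.trans hr₂, fun v hv => ?_, C₁ ∪ C₂, union_subset_union hC₁ hC₂, fun v hv => ?_,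
    fun v => if v ∈ A₁ then l₁ v else l₂ v, ⟨fun v hv => ?_, fun i => ?_⟩, fun v hv => ?_⟩
  · rw [mem_union, not_or] at hv
    rw [ho₂ v hv.2, ho₁ v hv.1]
  · simp only [mem_sdiff, mem_union, not_or] at hv
    rcases hv.1 with h | h
    · rw [ho₂ v (hd' v h)]
      exact hz₁ v (mem_sdiff.2 ⟨h, hv.2.1⟩)
    · exact hz₂ v (mem_sdiff.2 ⟨h, hv.2.2⟩)
  · rcases mem_union.1 hv with h | h
    · simp only [hC₁A v h, if_true]
      rw [ho₂ v (hd' v (hC₁A v h))]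
      exact ht₁.1 v h
    · simp only [hC₂A v h, if_false]
      exact ht₂.1 v h
  · have e : 2 ^ (k + 1 + μ) = 2 ^ (k + μ) + 2 ^ (k + μ) := by
      rw [← two_mul, ← pow_succ']; congr 1; omega
    rw [e]
    refine le_trans ?_ (add_le_add (ht₁.2 i) (ht₂.2 i))
    rw [← mul_add]
    refine Nat.mul_le_mul_left _ (le_trans (card_le_card ?_) (card_union_le _ _))
    intro v hv
    simp only [mem_filter, mem_union] at hv ⊢
    rcases hv.1 with h | h
    · left; simpa [h, hC₁A v h] using hv.2
    · right; simpa [h, hC₂A v h] using hv.2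
  · rcases mem_union.1 hv with h | h
    · simp only [hC₁A v h, if_true]; exact hl₁ v h
    · simp only [hC₂A v h, if_false]; exact hl₂ v h

/-- The ladder is built on exactly `2 ^ μ` points of `D`. The surplus points of `D` are treated as
carriers of class `0`, which is free because `Collects` uses labels from `1` on. -/
theorem Collects.hop {μ k T : ℕ} {A B D : Finset V} (h : Collects G μ A B k T)
    (hTμ : T + 3 ≤ μ) (hDA : Disjoint D A) (hD : 2 ^ μ ≤ #D) (hD' : #D ≤ 2 ^ (k + μ))
    (hadj : ∀ p ∈ D ∪ B, ∀ q ∈ D, p ≠ q → G.Adj p q) :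
    Collects G μ (A ∪ D) D k (T + k + 3) := by
  refine ⟨subset_union_right, fun w hw => ?_⟩
  have hd : ∀ v ∈ D, v ∉ A := fun v hv hv' => Finset.disjoint_left.1 hDA hv hv'
  obtain ⟨w₁, hr₁, ho₁, C, hC, hz₁, l, ht, hl⟩ := h.2 w fun v hv => hw v (mem_union_left _ hv)
  have hCA : ∀ v ∈ C, v ∈ A := fun v hv => h.1 (hC hv)
  have hw₁ : ∀ v ∈ D, w₁ v = 1 := fun v hv => by
    rw [ho₁ v (hd v hv), hw v (mem_union_right _ hv)]
  obtain ⟨E, hED, hEc⟩ := Finset.exists_subset_card_eq hD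
  have htame : IsTame w₁ ((D \ E) ∪ C) (2 ^ (k + μ)) (fun v => if v ∈ A then l v else 0) := by
    refine ⟨fun v hv => ?_, fun i => ?_⟩
    · rcases mem_union.1 hv with h | h
      · have := hd v (mem_sdiff.1 h).1
        simp [this, hw₁ v (mem_sdiff.1 h).1]
      · simpa [hCA v h] using ht.1 v h
    · rcases Nat.eq_zero_or_pos i with rfl | hi
      · rw [pow_zero, one_mul]
        refine (card_le_card fun v hv => ?_).trans hD'
        rw [mem_filter] at hv
        rcases mem_union.1 hv.1 with h | h
        · exact (mem_sdiff.1 h).1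
        · have h0 := hv.2
          simp only [hCA v h, if_true] at h0
          have := (hl v h).1
          omega
      · refine le_trans (Nat.mul_le_mul_left _ (card_le_card fun v hv => ?_)) (ht.2 i)
        rw [mem_filter] at hv ⊢
        rcases mem_union.1 hv.1 with h | h
        · have h0 := hv.2
          simp only [hd v (mem_sdiff.1 h).1, if_false] at h0
          omega
        · exact ⟨h, by simpa [hCA v h] using hv.2⟩
  have hEdis : Disjoint E (D \ E ∪ C) := Finset.disjoint_left.2 fun v hv hv' => by
    rcases mem_union.1 hv' with h | h
    · exact (mem_sdiff.1 h).2 hv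
    · exact hd v (hED hv) (hCA v h)
  have hsub : E ∪ (D \ E ∪ C) ⊆ D ∪ B := by
    refine union_subset (hED.trans subset_union_left) (union_subset ?_ ?_)
    · exact sdiff_subset.trans subset_union_left
    · exact hC.trans subset_union_right
  obtain ⟨w₂, hr₂, ho₂, hz₂, E₀, hE₀, hz₂', l', ht', hl'⟩ :=
    exists_hop (G := G) w₁ htame
      (fun v hv => by
        by_cases hvA : v ∈ A
        · rcases mem_union.1 hv with h | h
          · exact absurd hvA (hd v (mem_sdiff.1 h).1)
          · simpa [hvA] using (hl v h).2
        · simp [hvA]) hTμ hEc hEdis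
      (fun v hv => hw₁ v (hED hv)) (fun p hp q hq => hadj p (hsub hp) q (hED hq))
  refine ⟨w₂, hr₁.trans hr₂, fun v hv => ?_, E₀, hE₀.trans hED, fun v hv => ?_, l', ht', hl'⟩
  · rw [mem_union, not_or] at hv
    rw [ho₂ v, ho₁ v hv.1]
    intro hv'
    rcases mem_union.1 (hsub hv') with h' | h'
    · exact hv.2 h'
    · exact hv.1 (h.1 h')
  · rw [mem_sdiff, mem_union] at hv
    by_cases hE : v ∈ E
    · exact hz₂' v (mem_sdiff.2 ⟨hE, hv.2⟩)
    · rcases hv.1 with hv' | hv'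
      · by_cases hvC : v ∈ C
        · exact hz₂ v (mem_union_right _ hvC)
        · rw [ho₂ v, hz₁ v (mem_sdiff.2 ⟨hv', hvC⟩)]
          intro hv''
          rcases mem_union.1 hv'' with h' | h'
          · exact hE h'
          · rcases mem_union.1 h' with h' | h'
            · exact hd v (mem_sdiff.1 h').1 hv'
            · exact hvC h'
      · exact hz₂ v (mem_union_left _ (mem_sdiff.2 ⟨hv', hE⟩))

end Tree
-- Reduction to a configuration supported at one vertex
section Total

variable {V : Type*} {G : SimpleGraph V}

theorem Move.exists_pos {w w' : V → ℕ} (h : Move G w w') : ∃ v, 0 < w' v := by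
  obtain ⟨u, v, -, h0, -, -, hv, -⟩ := h
  exact ⟨v, by omega⟩

theorem Reaches.exists_pos {w w' : V → ℕ} (h : Reaches G w w') (h0 : ∃ v, 0 < w v) :
    ∃ v, 0 < w' v := by
  induction h with
  | refl => exact h0
  | tail _ h _ => exact h.exists_pos

/-- If all the weight can be moved to a single vertex, then the total acquisition number is `1`. -/
theorem totalAcquisition_eq_one (v₀ : V) {w : V → ℕ} (h : Reaches G (fun _ => 1) w)
    (hw : ∀ v, v ≠ v₀ → w v = 0) : totalAcquisition G = 1 := by
  have hpos : 0 < w v₀ := by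
    obtain ⟨v, hv⟩ := Reaches.exists_pos h ⟨v₀, one_pos⟩
    by_cases hvv : v = v₀
    · rwa [← hvv]
    · rw [hw v hvv] at hv; exact absurd hv (lt_irrefl 0)
  have hzero : ∀ v, 0 < w v → v = v₀ := fun v hv => by
    by_contra hne
    rw [hw v hne] at hv; exact absurd hv (lt_irrefl 0)
  refine le_antisymm ?_ ?_
  · refine (iInf₂_le {v | 0 < w v} ⟨w, h, ?_, rfl⟩).trans ?_
    · rw [Set.encard_le_one_iff]
      exact fun a b ha hb => (hzero a ha).trans (hzero b hb).symm
    · rintro w' ⟨u, v, huv, hu, huv', -⟩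
      exact huv.ne ((hzero u hu).trans (hzero v (hu.trans_le huv')).symm)
  · refine le_iInf₂ fun R hR => ?_
    obtain ⟨w', hr, -, rfl⟩ := hR
    rw [Set.one_le_encard_iff_nonempty]
    exact Reaches.exists_pos hr ⟨v₀, one_pos⟩

end Total

/-! ### Rings, sectors and the cost of sweeping inwards -/

section Cones

variable {V : Type*} [DecidableEq V] {G : SimpleGraph V}

/-- If `D` is a clique that sees `B`, then everything can be moved to one vertex of `D`. -/
theorem Collects.finish [Fintype V] {μ k T : ℕ} {A B D : Finset V} (h : Collects G μ A B k T)
    (hTμ : T ≤ μ) (hDA : Disjoint D A) (hD : 2 ^ μ ≤ #D) (huniv : A ∪ D = univ)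
    (hadj : ∀ p ∈ D ∪ B, ∀ q ∈ D, p ≠ q → G.Adj p q) :
    ∃ v₀ w, Reaches G (fun _ => 1) w ∧ ∀ v, v ≠ v₀ → w v = 0 := by
  obtain ⟨w₁, hr₁, ho₁, C, hC, hz₁, l, ht, hl⟩ := h.2 (fun _ => 1) fun _ _ => rfl
  have hd : ∀ v ∈ D, v ∉ A := fun v hv hv' => Finset.disjoint_left.1 hDA hv hv'
  obtain ⟨v₀, hv₀⟩ : D.Nonempty := Finset.card_pos.1 ((Nat.two_pow_pos μ).trans_le hD)
  have hCA : ∀ v ∈ C, v ∈ A := fun v hv => h.1 (hC hv)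
  have hw₁ : ∀ v ∈ D, w₁ v = 1 := fun v hv => ho₁ v (hd v hv)
  -- Pooling the clique first gives `v₀` weight `#D ≥ 2 ^ μ ≥ 2 ^ T`, so no carrier is heavier than
  -- `v₀`.
  set w₂ := absorbed w₁ (D.erase v₀) fun _ => v₀ with hw₂
  have hr₂ : Reaches G w₁ w₂ := reaches_absorbed _ _ _ fun c hc => by
    rw [mem_erase] at hc
    exact ⟨hadj c (mem_union_left _ hc.2) v₀ hv₀ hc.1, by simp, by rw [hw₁ c hc.2, hw₁ v₀ hv₀]⟩
  have hbig : w₂ v₀ = #D := by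
    rw [hw₂, absorbed_of_notMem (by simp), hw₁ v₀ hv₀, Finset.filter_true_of_mem fun _ _ => rfl,
      Finset.sum_congr rfl fun c hc => hw₁ c (mem_erase.1 hc).2, Finset.sum_const, smul_eq_mul,
      mul_one, Finset.card_erase_of_mem hv₀]
    have := Finset.card_pos.2 ⟨v₀, hv₀⟩
    omega
  have hsame : ∀ v ∈ A, w₂ v = w₁ v := fun v hv =>
    absorbed_of_forall_ne (fun h' => hd v (mem_erase.1 h').2 hv) fun _ _ h' => hd v (h' ▸ hv₀) hv
  refine ⟨v₀, absorbed w₂ C fun _ => v₀, (hr₁.trans hr₂).trans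
    (reaches_absorbed _ _ _ fun c hc => ⟨?_, fun h' => hd v₀ hv₀ (hCA _ h'), ?_⟩), ?_⟩
  · exact hadj c (mem_union_right _ (hC hc)) v₀ hv₀ fun h' => hd v₀ hv₀ (h' ▸ hCA c hc)
  · rw [hsame c (hCA c hc), hbig]
    exact (ht.1 c hc).trans
      ((Nat.pow_le_pow_right two_pos ((hl c hc).2.trans hTμ)).trans hD)
  · intro v hv
    by_cases hvC : v ∈ C
    · exact absorbed_of_mem hvC
    · rw [absorbed_of_forall_ne hvC fun _ _ h' => hv h'.symm]
      have : v ∈ A ∪ D := huniv ▸ mem_univ v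
      rcases mem_union.1 this with h' | h'
      · rw [hsame v h']; exact hz₁ v (mem_sdiff.2 ⟨h', hvC⟩)
      · exact absorbed_of_mem (mem_erase.2 ⟨hv, h'⟩)

/-- The sum of the costs of the rings `g, …, 2 ^ J - 1`. -/
def ringCost (k₀ J g : ℕ) : ℕ := ∑ i ∈ Ico g (2 ^ J), (k₀ + (J - Nat.log 2 i) + 3)

theorem ringCost_le_total (k₀ J g : ℕ) : ringCost k₀ J g ≤ ringCost k₀ J 0 :=
  Finset.sum_le_sum_of_subset (Finset.Ico_subset_Ico_left (Nat.zero_le _))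

theorem ringCost_eq_add {k₀ J g : ℕ} (h : g < 2 ^ J) :
    ringCost k₀ J g = ringCost k₀ J (g + 1) + (k₀ + (J - Nat.log 2 g)) + 3 := by
  rw [ringCost, Finset.sum_eq_sum_Ico_succ_bot h, ringCost]; ring

/-- Passing from `J` to `J + 1` raises each old term by at most one and adds `2 ^ J` new terms, each
at most one. The sum is thus linear in `2 ^ J`, without a factor `J`. -/
theorem sum_sub_log_le (J : ℕ) : ∑ i ∈ range (2 ^ J), (J - Nat.log 2 i) + J ≤ 3 * 2 ^ J := by
  induction J with
  | zero => simp
  | succ J ih =>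
    have e : 2 ^ (J + 1) = 2 ^ J + 2 ^ J := by rw [pow_succ']; ring
    rw [e, Finset.sum_range_add]
    have h1 : ∑ i ∈ range (2 ^ J), (J + 1 - Nat.log 2 i)
        ≤ ∑ i ∈ range (2 ^ J), (J - Nat.log 2 i) + 2 ^ J := by
      refine (Finset.sum_le_sum (g := fun i => (J - Nat.log 2 i) + 1) fun i _ => by omega).trans ?_
      rw [Finset.sum_add_distrib]; simp
    have h2 : ∑ i ∈ range (2 ^ J), (J + 1 - Nat.log 2 (2 ^ J + i)) ≤ 2 ^ J := by
      refine (Finset.sum_le_sum (g := fun _ => 1) fun i _ => ?_).trans (by simp)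
      have : J ≤ Nat.log 2 (2 ^ J + i) :=
        Nat.le_log_of_pow_le one_lt_two (Nat.le_add_right _ _)
      omega
    have := Nat.one_le_two_pow (n := J)
    omega

theorem ringCost_zero_le (k₀ J : ℕ) : ringCost k₀ J 0 ≤ (k₀ + 6) * 2 ^ J := by
  have h := sum_sub_log_le J
  have : ringCost k₀ J 0 = ∑ i ∈ range (2 ^ J), (J - Nat.log 2 i) + 2 ^ J * (k₀ + 3) := by
    rw [ringCost, Nat.Ico_zero_eq_range]
    simp only [show ∀ i, k₀ + (J - Nat.log 2 i) + 3 = (J - Nat.log 2 i) + (k₀ + 3) from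
      fun i => by ring]
    rw [Finset.sum_add_distrib]; simp
  rw [this]
  nlinarith

/-- The points with ring index `g` in the sector `s`, where the `g`-th ring is divided into
`2 ^ (Nat.log 2 g)` sectors. -/
def ringBlock [Fintype V] (ring sec : V → ℕ) (J g s : ℕ) : Finset V :=
  {v | ring v = g ∧ sec v / 2 ^ (J - Nat.log 2 g) = s}

/-- The points with ring index at least `g` in the sector `s` of the `g`-th ring. -/
def ringCone [Fintype V] (ring sec : V → ℕ) (J g s : ℕ) : Finset V :=
  {v | g ≤ ring v ∧ sec v / 2 ^ (J - Nat.log 2 g) = s}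

theorem log_succ_cases (g : ℕ) : Nat.log 2 (g + 1) = Nat.log 2 g ∨
    Nat.log 2 (g + 1) = Nat.log 2 g + 1 := by
  rcases Nat.eq_zero_or_pos g with rfl | hg
  · left; simp
  have h1 : Nat.log 2 g ≤ Nat.log 2 (g + 1) := Nat.log_mono_right (Nat.le_succ g)
  have h2 : Nat.log 2 (g + 1) < Nat.log 2 g + 2 := by
    refine Nat.log_lt_of_lt_pow (by omega) ?_
    have := Nat.lt_pow_succ_log_self one_lt_two g
    rw [pow_succ]
    omega
  omega

/-- Induction from the outermost ring inwards, with `m` counting the rings from `g` on; for `m = 0`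
everything is empty. What lies beyond ring `g` in a sector is one cone or, when `g + 1` is a power
of two, the union of two; it then hops onto the block of ring `g`. -/
theorem collects_ringCone [Fintype V] {ring sec : V → ℕ} {J μ k₀ : ℕ}
    (hring : ∀ v, ring v < 2 ^ J)
    (hadj : ∀ u v, u ≠ v → ring v ≤ ring u → ring u ≤ ring v + 1 →
      sec u / 2 ^ (J - Nat.log 2 (ring v)) = sec v / 2 ^ (J - Nat.log 2 (ring v)) → G.Adj u v)
    (hlo : ∀ g < 2 ^ J, ∀ s < 2 ^ Nat.log 2 g, 2 ^ μ ≤ #(ringBlock ring sec J g s))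
    (hhi : ∀ g < 2 ^ J, ∀ s < 2 ^ Nat.log 2 g, #(ringBlock ring sec J g s) ≤ 2 ^ (k₀ + μ))
    (hμ : (k₀ + 6) * 2 ^ J ≤ μ) (m : ℕ) :
    ∀ g, 1 ≤ g → g + m = 2 ^ J → ∀ s < 2 ^ Nat.log 2 g,
      Collects G μ (ringCone ring sec J g s) (ringBlock ring sec J g s)
        (k₀ + (J - Nat.log 2 g)) (ringCost k₀ J g) := by
  induction m with
  | zero =>
    intro g _ hg s _
    have h1 : ringCone ring sec J g s = ∅ := by
      refine Finset.filter_false_of_mem fun v _ h => ?_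
      have := hring v
      omega
    have h2 : ringBlock ring sec J g s = ∅ := by
      refine Finset.filter_false_of_mem fun v _ h => ?_
      have := hring v
      omega
    rw [h1, h2]
    exact collects_empty _ _ _
  | succ m ih =>
    intro g hg1 hgm s hs
    have hgJ : g < 2 ^ J := by omega
    have hlogJ : Nat.log 2 g < J := Nat.log_lt_of_lt_pow (by omega) hgJ
    set i := Nat.log 2 g with hi
    -- everything beyond the ring, in the same sector
    have hpre : Collects G μ ({v | g + 1 ≤ ring v ∧ sec v / 2 ^ (J - i) = s} : Finset V)
        ({v | ring v = g + 1 ∧ sec v / 2 ^ (J - i) = s} : Finset V)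
        (k₀ + (J - i)) (ringCost k₀ J (g + 1)) := by
      rcases log_succ_cases g with h | h
      · have := ih (g + 1) (by omega) (by omega) s (by rw [h]; exact hs)
        rw [ringCone, ringBlock, h] at this
        exact this
      · have hs1 : 2 * s + 1 < 2 ^ (i + 1) := by rw [pow_succ']; omega
        have c1 := ih (g + 1) (by omega) (by omega) (2 * s) (by rw [h, ← hi]; omega)
        have c2 := ih (g + 1) (by omega) (by omega) (2 * s + 1) (by rw [h, ← hi]; omega)
        rw [ringCone, ringBlock, h] at c1 c2
        -- Sector `s` of the coarser division consists of the sectors `2 * s` and `2 * s + 1` of the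
        -- finer one.
        have hdiv : ∀ v, sec v / 2 ^ (J - i) = s ↔
            sec v / 2 ^ (J - (i + 1)) = 2 * s ∨ sec v / 2 ^ (J - (i + 1)) = 2 * s + 1 := by
          intro v
          rw [show J - i = J - (i + 1) + 1 by omega, pow_succ, ← Nat.div_div_eq_div_mul]
          omega
        have c := c1.union c2 (Finset.disjoint_left.2 fun v hv hv' => by
          have h1 := (mem_filter.1 hv).2.2
          have h2 := (mem_filter.1 hv').2.2
          omega)
        rw [← Finset.filter_or, ← Finset.filter_or] at c
        simp only [← and_or_left, ← hi] at c
        simp only [hdiv]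
        rwa [show k₀ + (J - (i + 1)) + 1 = k₀ + (J - i) by omega] at c
    have hT := (ringCost_eq_add (k₀ := k₀) hgJ).symm.le.trans
      ((ringCost_le_total k₀ J g).trans (ringCost_zero_le k₀ J))
    have := hpre.hop (D := ringBlock ring sec J g s) (by omega)
      (Finset.disjoint_left.2 fun v hv hv' => by
        have h1 := (mem_filter.1 hv).2.1
        have h2 := (mem_filter.1 hv').2.1
        omega)
      (hlo g hgJ s hs)
      ((hhi g hgJ s hs).trans (Nat.pow_le_pow_right two_pos (by omega)))
      (fun p hp q hq hne => by
        have h2 := (mem_filter.1 hq).2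
        rcases mem_union.1 hp with hp | hp
        all_goals
          have h1 := (mem_filter.1 hp).2
          refine hadj p q hne (by omega) (by omega) ?_
          rw [h2.1]
          exact h1.2.trans h2.2.symm)
    rw [ringCost_eq_add hgJ]
    convert this using 1
    ext v
    simp only [ringCone, ringBlock, mem_filter, mem_univ, true_and, mem_union, ← hi]
    omega

/-- A combinatorial criterion for total acquisition number `1`. -/
theorem totalAcquisition_eq_one_of_rings [Finite V] {ring sec : V → ℕ} {J μ k₀ : ℕ}
    (hring : ∀ v, ring v < 2 ^ J) (hsec : ∀ v, sec v < 2 ^ J)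
    (hadj : ∀ u v, u ≠ v → ring v ≤ ring u → ring u ≤ ring v + 1 →
      sec u / 2 ^ (J - Nat.log 2 (ring v)) = sec v / 2 ^ (J - Nat.log 2 (ring v)) → G.Adj u v)
    (hlo : ∀ g < 2 ^ J, ∀ s < 2 ^ Nat.log 2 g,
      2 ^ μ ≤ {v | ring v = g ∧ sec v / 2 ^ (J - Nat.log 2 g) = s}.ncard)
    (hhi : ∀ g < 2 ^ J, ∀ s < 2 ^ Nat.log 2 g,
      {v | ring v = g ∧ sec v / 2 ^ (J - Nat.log 2 g) = s}.ncard ≤ 2 ^ (k₀ + μ))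
    (hμ : (k₀ + 6) * 2 ^ J ≤ μ) : totalAcquisition G = 1 := by
  have := Fintype.ofFinite V
  have hcard : ∀ g s, {v | ring v = g ∧ sec v / 2 ^ (J - Nat.log 2 g) = s}.ncard
      = #(ringBlock ring sec J g s) := fun g s => by
    rw [← Set.ncard_coe_finset]; congr 1; ext v; simp [ringBlock]
  simp only [hcard] at hlo hhi
  have hJ := Nat.two_pow_pos J
  -- Rings `0` and `1` both have a single sector, since `Nat.log 2 0 = Nat.log 2 1 = 0`.
  have hsec0 : ∀ v, sec v / 2 ^ J = 0 := fun v => Nat.div_eq_of_lt (hsec v)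
  have hcol : Collects G μ ({v | 1 ≤ ring v} : Finset V) ({v | ring v = 1} : Finset V)
      (k₀ + J) (ringCost k₀ J 1) := by
    have := collects_ringCone hring hadj hlo hhi hμ (2 ^ J - 1) 1 le_rfl (by omega) 0 (by simp)
    simpa [ringCone, ringBlock, hsec0] using this
  have hD : ringBlock ring sec J 0 0 = ({v | ring v = 0} : Finset V) := by
    simp [ringBlock, hsec0]
  have hlo0 := hlo 0 hJ 0 (by simp)
  rw [hD] at hlo0
  obtain ⟨v₀, w, hw, hw'⟩ := hcol.finish (D := ({v | ring v = 0} : Finset V))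
    ((ringCost_le_total k₀ J 1).trans ((ringCost_zero_le k₀ J).trans hμ))
    (Finset.disjoint_left.2 fun v hv hv' => by
      have h1 := (mem_filter.1 hv).2
      have h2 := (mem_filter.1 hv').2
      omega) hlo0
    (by
      ext v
      simp only [mem_union, mem_filter, mem_univ, true_and, iff_true]
      omega)
    (fun p hp q hq hne => by
      have h2 := (mem_filter.1 hq).2
      have h1 : ring p ≤ 1 := by
        rcases mem_union.1 hp with hp | hp
        all_goals
          have h1 := (mem_filter.1 hp).2
          omega
      refine hadj p q hne (by omega) (by omega) ?_
      simp [h2, hsec0])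
  exact totalAcquisition_eq_one v₀ hw hw'

end Cones
/-! ### Square polar coordinates in the positive quadrant -/

/-- The angular coordinate `(v - u) / max u v`, which increases from `-1` to `1` along the upper
right part of the boundary of a square with a corner at the origin. -/
noncomputable def angle (u v : ℝ) : ℝ := (v - u) / max u v

theorem angle_swap (u v : ℝ) : angle v u = -angle u v := by
  rw [angle, angle, max_comm, ← neg_div, neg_sub]

theorem angle_lt_one {u : ℝ} (hu : 0 < u) (v : ℝ) : angle u v < 1 := by
  have h := le_max_right u v
  have h0 : 0 < max u v := lt_max_of_lt_left hu
  rw [angle, div_lt_one h0]; linarith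

theorem neg_one_lt_angle (u : ℝ) {v : ℝ} (hv : 0 < v) : -1 < angle u v := by
  have := angle_lt_one hv u
  rw [angle_swap] at this; linarith

theorem fst_eq_max_mul {u v : ℝ} (hu : 0 < u) :
    u = max u v * min 1 (1 - angle u v) := by
  have h0 : 0 < max u v := lt_max_of_lt_left hu
  rw [mul_min_of_nonneg _ _ h0.le, mul_sub, angle, mul_div_cancel₀ _ h0.ne']
  rcases le_total u v with h | h
  · rw [max_eq_right h, min_eq_right (by linarith)]; ring
  · rw [max_eq_left h, min_eq_left (by linarith)]; ring

/-- In square polar coordinates `u` is the radius times `min 1 (1 - angle)`, a factor bounded by `1`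
and 1-Lipschitz in the angle. -/
theorem abs_fst_sub_le {u v u' v' : ℝ} (hu : 0 < u) (hu' : 0 < u') :
    |u - u'| ≤ |max u v - max u' v'| + max u' v' * |angle u v - angle u' v'| := by
  have h0' : 0 < max u' v' := lt_max_of_lt_left hu'
  set m := min 1 (1 - angle u v) with hm
  set m' := min 1 (1 - angle u' v') with hm'
  have e : u - u' = (max u v - max u' v') * m + max u' v' * (m - m') := by
    conv_lhs => rw [fst_eq_max_mul hu, fst_eq_max_mul hu', ← hm, ← hm']
    ring
  have hm1 : |m| ≤ 1 := by
    rw [abs_le]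
    exact ⟨le_min (by norm_num) (by have := angle_lt_one hu v; linarith), min_le_left _ _⟩
  have hmm : |m - m'| ≤ |angle u v - angle u' v'| := by
    have := abs_min_sub_min_le_max 1 (1 - angle u v) 1 (1 - angle u' v')
    rw [sub_self, abs_zero, max_eq_right (abs_nonneg _)] at this
    rwa [abs_sub_comm (angle u v), show angle u' v' - angle u v
      = 1 - angle u v - (1 - angle u' v') by ring]
  rw [e]
  refine (abs_add_le _ _).trans (add_le_add ?_ ?_)
  · rw [abs_mul]; exact mul_le_of_le_one_right (abs_nonneg _) hm1
  · rw [abs_mul, abs_of_pos h0']; exact mul_le_mul_of_nonneg_left hmm h0'.le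

theorem abs_snd_sub_le {u v u' v' : ℝ} (hv : 0 < v) (hv' : 0 < v') :
    |v - v'| ≤ |max u v - max u' v'| + max u' v' * |angle u v - angle u' v'| := by
  have := abs_fst_sub_le (v := u) (v' := u') hv hv'
  rwa [angle_swap u v, angle_swap u' v', max_comm v u, max_comm v' u', neg_sub_neg,
    abs_sub_comm (angle u' v')] at this

/-- A point with given square polar coordinates. -/
theorem exists_polar {ρ τ : ℝ} (hρ : 0 < ρ) (hτ : -1 < τ) (hτ' : τ < 1) :
    ∃ u v : ℝ, 0 < u ∧ 0 < v ∧ max u v = ρ ∧ angle u v = τ := by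
  rcases le_total τ 0 with h | h
  · have hm : max ρ (ρ * (1 + τ)) = ρ := max_eq_left (by nlinarith)
    refine ⟨ρ, ρ * (1 + τ), hρ, by nlinarith, hm, ?_⟩
    rw [angle, hm]; field_simp; ring
  · have hm : max (ρ * (1 - τ)) ρ = ρ := max_eq_right (by nlinarith)
    refine ⟨ρ * (1 - τ), ρ, by nlinarith, hρ, hm, ?_⟩
    rw [angle, hm]; field_simp; ring

/-- Since angle times radius is `v - u`, the difference splits into the changes of `u`, of `v` and
of the radius, the last multiplied by an angle of modulus at most `1`. Each is at most `δ`. -/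
theorem abs_angle_sub_mul_le {u v u' v' δ : ℝ} (hu : 0 < u) (hu' : 0 < u')
    (hv' : 0 < v') (h₁ : |u - u'| ≤ δ) (h₂ : |v - v'| ≤ δ) :
    |angle u v - angle u' v'| * max u v ≤ 3 * δ := by
  have h0 : 0 < max u v := lt_max_of_lt_left hu
  have h0' : 0 < max u' v' := lt_max_of_lt_left hu'
  have e : (angle u v - angle u' v') * max u v
      = (v - v') - (u - u') + angle u' v' * (max u' v' - max u v) := by
    have e1 : angle u v * max u v = v - u := div_mul_cancel₀ _ h0.ne'
    have e2 : angle u' v' * max u' v' = v' - u' := div_mul_cancel₀ _ h0'.ne'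
    linear_combination e1 - e2
  have h3 : |max u' v' - max u v| ≤ δ := by
    rw [abs_sub_comm]
    exact (abs_max_sub_max_le_max _ _ _ _).trans (max_le h₁ h₂)
  have h4 : |angle u' v'| ≤ 1 :=
    abs_le.2 ⟨(neg_one_lt_angle u' hv').le, (angle_lt_one hu' v').le⟩
  have h5 : |angle u' v' * (max u' v' - max u v)| ≤ δ := by
    rw [abs_mul]
    exact (mul_le_of_le_one_left (abs_nonneg _) h4).trans h3
  rw [← abs_of_pos h0, ← abs_mul, e, abs_le]
  rw [abs_le] at h₁ h₂ h5
  constructor <;> linarith [h₁.1, h₁.2, h₂.1, h₂.2, h5.1, h5.2]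

/-! ### Rings and sectors -/

/-- The index of the ring, of thickness `e`, that contains the point. -/
noncomputable def ringIndex (e u v : ℝ) : ℕ := ⌊max u v / e⌋₊

/-- The index of the sector, among `2 ^ J` sectors, that contains the point. -/
noncomputable def sectorIndex (J : ℕ) (u v : ℝ) : ℕ := ⌊(angle u v + 1) / 2 * 2 ^ J⌋₊

theorem sectorIndex_lt {u : ℝ} (hu : 0 < u) (v : ℝ) (J : ℕ) :
    sectorIndex J u v < 2 ^ J := by
  have h1 := angle_lt_one hu v
  have h2 : (0 : ℝ) < 2 ^ J := by positivity
  refine (Nat.floor_lt' (by positivity)).2 ?_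
  push_cast
  nlinarith

/-- The dyadic divisions are nested, so the index at the finest level `J` determines all coarser
ones. -/
theorem sectorIndex_div {i J : ℕ} (h : i ≤ J) (u v : ℝ) :
    sectorIndex J u v / 2 ^ (J - i) = sectorIndex i u v := by
  rw [sectorIndex, sectorIndex, ← Nat.floor_div_natCast]
  congr 1
  obtain ⟨d, rfl⟩ := Nat.exists_eq_add_of_le h
  rw [Nat.add_sub_cancel_left, pow_add]
  push_cast
  field_simp

theorem abs_sub_lt_one_of_floor_eq {a b : ℝ} (ha : 0 ≤ a) (hb : 0 ≤ b) (h : ⌊a⌋₊ = ⌊b⌋₊) :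
    |a - b| < 1 := by
  have h1 := Nat.floor_le ha
  have h2 := Nat.floor_le hb
  have h3 := Nat.lt_floor_add_one a
  have h4 := Nat.lt_floor_add_one b
  rw [h] at h1 h3
  rw [abs_lt]; constructor <;> linarith

theorem abs_angle_sub_lt {u v u' v' : ℝ} {i : ℕ} (hv : 0 < v) (hv' : 0 < v')
    (h : sectorIndex i u v = sectorIndex i u' v') :
    |angle u v - angle u' v'| * 2 ^ i < 2 := by
  have h1 := neg_one_lt_angle u hv
  have h1' := neg_one_lt_angle u' hv'
  have hp : (0 : ℝ) < 2 ^ i := by positivity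
  have := abs_sub_lt_one_of_floor_eq (a := (angle u v + 1) / 2 * 2 ^ i)
    (b := (angle u' v' + 1) / 2 * 2 ^ i) (mul_nonneg (by linarith) hp.le)
    (mul_nonneg (by linarith) hp.le) h
  rw [show (angle u v + 1) / 2 * 2 ^ i - (angle u' v' + 1) / 2 * 2 ^ i
    = (angle u v - angle u' v') * (2 ^ i / 2) by ring, abs_mul, abs_of_pos (half_pos hp)] at this
  linarith

/-- Points in the same sector and in neighbouring rings are close to each other. -/
theorem abs_sub_le_of_ringIndex {e u v u' v' : ℝ} (he : 0 < e) (hu : 0 < u) (hv : 0 < v)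
    (hu' : 0 < u') (hv' : 0 < v') (h₁ : ringIndex e u' v' ≤ ringIndex e u v)
    (h₂ : ringIndex e u v ≤ ringIndex e u' v' + 1)
    (hs : sectorIndex (Nat.log 2 (ringIndex e u' v')) u v
      = sectorIndex (Nat.log 2 (ringIndex e u' v')) u' v') :
    |u - u'| ≤ 6 * e ∧ |v - v'| ≤ 6 * e := by
  have h0 : 0 < max u v := lt_max_of_lt_left hu
  have h0' : 0 < max u' v' := lt_max_of_lt_left hu'
  have hang := abs_angle_sub_lt hv hv' hs
  set g := ringIndex e u' v' with hg
  set i := Nat.log 2 g with hi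
  have hgi : g + 1 ≤ 2 ^ (i + 1) := Nat.lt_pow_succ_log_self one_lt_two g
  have hgi' : (g : ℝ) + 1 ≤ 2 * 2 ^ i := by rw [← pow_succ']; exact_mod_cast hgi
  have f1 := Nat.floor_le (div_nonneg h0'.le he.le)
  have f2 := Nat.lt_floor_add_one (max u' v' / e)
  have f3 := Nat.floor_le (div_nonneg h0.le he.le)
  have f4 := Nat.lt_floor_add_one (max u v / e)
  rw [← ringIndex, ← hg, le_div_iff₀ he] at f1
  rw [← ringIndex, ← hg, div_lt_iff₀ he] at f2
  rw [← ringIndex, le_div_iff₀ he] at f3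
  rw [← ringIndex, div_lt_iff₀ he] at f4
  have c1 : (g : ℝ) ≤ ringIndex e u v := by exact_mod_cast h₁
  have c2 : (ringIndex e u v : ℝ) ≤ g + 1 := by exact_mod_cast h₂
  have hρ : |max u v - max u' v'| ≤ 2 * e := by
    rw [abs_le]; constructor <;> nlinarith
  have hp : (0 : ℝ) < 2 ^ i := by positivity
  -- The angles differ by less than `2 / 2 ^ i`, while the radius is below `(g + 1) * e ≤ 2 * 2 ^ i
  -- * e`.
  have hτ : max u' v' * |angle u v - angle u' v'| ≤ 4 * e := by
    have hm : max u' v' ≤ 2 * 2 ^ i * e := f2.le.trans (mul_le_mul_of_nonneg_right hgi' he.le)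
    calc max u' v' * |angle u v - angle u' v'|
        ≤ 2 * 2 ^ i * e * |angle u v - angle u' v'| :=
          mul_le_mul_of_nonneg_right hm (abs_nonneg _)
      _ = 2 * e * (|angle u v - angle u' v'| * 2 ^ i) := by ring
      _ ≤ 2 * e * 2 := mul_le_mul_of_nonneg_left hang.le (by positivity)
      _ = 4 * e := by ring
  exact ⟨(abs_fst_sub_le hu hu').trans (by linarith),
    (abs_snd_sub_le hv hv').trans (by linarith)⟩

/-- Every block contains all points close to some point of the square. -/
theorem exists_center_of_block {e : ℝ} (he : 0 < e) {J g s : ℕ} (hg : g < 2 ^ J)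
    (hs : s < 2 ^ Nat.log 2 g) :
    ∃ u₀ v₀ : ℝ, 0 < u₀ ∧ u₀ < e * 2 ^ J ∧ 0 < v₀ ∧ v₀ < e * 2 ^ J ∧
      ∀ u v : ℝ, 0 < u → 0 < v → |u - u₀| ≤ e / 8 → |v - v₀| ≤ e / 8 →
        ringIndex e u v = g ∧ sectorIndex (Nat.log 2 g) u v = s := by
  set i := Nat.log 2 g with hi
  have hp : (0 : ℝ) < 2 ^ i := by positivity
  have hs' : (s : ℝ) + 1 ≤ 2 ^ i := by exact_mod_cast hs
  have hg' : (g : ℝ) + 1 ≤ 2 ^ J := by exact_mod_cast hg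
  have hs0 : (0 : ℝ) ≤ s := Nat.cast_nonneg s
  have hg0 : (0 : ℝ) ≤ g := Nat.cast_nonneg g
  set τ : ℝ := (2 * s + 1) / 2 ^ i - 1 with hτ
  have hτe : (τ + 1) * 2 ^ i = 2 * s + 1 := by rw [hτ]; field_simp; ring
  -- The point in the middle of the block, both radially and in angle.
  obtain ⟨u₀, v₀, hu₀, hv₀, hmax, hang⟩ := exists_polar (ρ := e * (g + 1 / 2)) (τ := τ)
    (by positivity) (by rw [hτ]; have : (0 : ℝ) < (2 * s + 1) / 2 ^ i := by positivity
                        linarith)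
    (by rw [hτ, sub_lt_iff_lt_add, div_lt_iff₀ hp]; linarith)
  have hlt : e * ((g : ℝ) + 1 / 2) < e * 2 ^ J := mul_lt_mul_of_pos_left (by linarith) he
  refine ⟨u₀, v₀, hu₀, (le_max_left _ _).trans_lt (hmax ▸ hlt), hv₀,
    (le_max_right _ _).trans_lt (hmax ▸ hlt), fun u v hu hv h1 h2 => ?_⟩
  have hρ : |max u v - max u₀ v₀| ≤ e / 8 :=
    (abs_max_sub_max_le_max _ _ _ _).trans (max_le h1 h2)
  rw [hmax, abs_le] at hρ
  refine ⟨?_, ?_⟩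
  · rw [ringIndex, Nat.floor_eq_iff (div_nonneg (lt_max_of_lt_left hu).le he.le),
      le_div_iff₀ he, div_lt_iff₀ he]
    constructor <;> nlinarith [hρ.1, hρ.2]
  · rcases Nat.eq_zero_or_pos g with h0 | h0
    · have hi0 : i = 0 := by rw [hi, h0]; simp
      have := sectorIndex_lt hu v i
      rw [hi0] at this hs ⊢
      rw [pow_zero] at this hs
      omega
    · have hgi : (2 : ℝ) ^ i ≤ g := by exact_mod_cast Nat.pow_log_le_self 2 h0.ne'
      have h3 := abs_angle_sub_mul_le hu hu₀ hv₀ h1 h2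
      rw [hang] at h3
      have hm : e * 2 ^ i ≤ max u v := by nlinarith [hρ.1]
      -- The quantity rounded down in `sectorIndex` thus stays within `3 / 16` of `s + 1 / 2`.
      have h4 : |angle u v - τ| * 2 ^ i ≤ 3 / 8 := by
        have h5 : |angle u v - τ| * (e * 2 ^ i) ≤ |angle u v - τ| * max u v :=
          mul_le_mul_of_nonneg_left hm (abs_nonneg _)
        have h6 : e * (|angle u v - τ| * 2 ^ i) ≤ e * (3 / 8) := by linarith
        exact le_of_mul_le_mul_left h6 he
      rw [← abs_of_pos hp, ← abs_mul, abs_le] at h4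
      rw [sectorIndex, Nat.floor_eq_iff]
      · constructor <;> nlinarith [h4.1, h4.2]
      · have := neg_one_lt_angle u hv
        exact mul_nonneg (by linarith) hp.le

/-! ### Counting points of blocks by cells -/

/-- A set of points contained in a box of `m × m` cells, each of which contains at most `N` points,
has at most `N * m ^ 2` points. -/
theorem card_le_of_cells {V : Type*} [Fintype V] [DecidableEq V] {a b : V → ℕ} {N a₀ b₀ d : ℕ}
    (D : Finset V) (hN : ∀ i j, #{x | a x = i ∧ b x = j} ≤ N)
    (ha : ∀ x ∈ D, a₀ ≤ a x + d ∧ a x ≤ a₀ + d) (hb : ∀ x ∈ D, b₀ ≤ b x + d ∧ b x ≤ b₀ + d) :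
    #D ≤ N * (2 * d + 1) ^ 2 := by
  have h1 := Finset.card_le_mul_card_image_of_maps_to (s := D)
    (t := Icc (a₀ - d) (a₀ + d) ×ˢ Icc (b₀ - d) (b₀ + d)) (f := fun x => (a x, b x))
    (fun x hx => by
      have := ha x hx
      have := hb x hx
      simp only [mem_product, mem_Icc]
      omega) N
    (fun p _ => (card_le_card fun x hx => by
      rw [mem_filter] at hx
      simp [← hx.2]).trans (hN p.1 p.2))
  refine h1.trans (Nat.mul_le_mul_left _ ?_)
  rw [card_product, Nat.card_Icc, Nat.card_Icc, sq]
  exact Nat.mul_le_mul (by omega) (by omega)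

theorem floor_le_floor_add {a b : ℝ} {d : ℕ} (ha : 0 ≤ a) (h : |a - b| ≤ d) :
    ⌊b⌋₊ ≤ ⌊a⌋₊ + d := by
  rw [← Nat.floor_add_natCast ha]
  refine Nat.floor_le_floor ?_
  rw [abs_le] at h
  linarith [h.1]

/-- The total acquisition number is `1` for the points in a square with evenly filled cells. -/
theorem totalAcquisition_eq_one_of_cells {V : Type*} [Finite V] {G : SimpleGraph V} {u v : V → ℝ}
    {r L s : ℝ} {ℓ : ℕ} (hr : 0 < r) (hu : ∀ x, 0 < u x) (huL : ∀ x, u x < L) (hv : ∀ x, 0 < v x)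
    (hvL : ∀ x, v x < L)
    (hadj : ∀ x y, x ≠ y → |u x - u y| ≤ 3 / 10 * r → |v x - v y| ≤ 3 / 10 * r → G.Adj x y)
    (hL : L = ℓ * s) (hs₁ : r ≤ 20000 * s) (hs₂ : 10000 * s ≤ r) (hLr : r ≤ 20 * L)
    (hlo : ∀ a < ℓ, ∀ b < ℓ, 99 / 100 * s ^ 2 ≤ ({x | u x ∈ Set.Ico (a * s) ((a + 1) * s) ∧
      v x ∈ Set.Ico (b * s) ((b + 1) * s)}.ncard : ℝ))
    (hhi : ∀ a < ℓ, ∀ b < ℓ, ({x | u x ∈ Set.Ico (a * s) ((a + 1) * s) ∧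
      v x ∈ Set.Ico (b * s) ((b + 1) * s)}.ncard : ℝ) ≤ 101 / 100 * s ^ 2)
    (hbig : 2 * (2 : ℝ) ^ (1440 * L / r) ≤ 99 / 100 * s ^ 2) : totalAcquisition G = 1 := by
  classical
  have := Fintype.ofFinite V
  have hs : 0 < s := by linarith
  have hL0 : 0 < L := by linarith
  -- the scale of the rings
  obtain ⟨n, hn, hn'⟩ := exists_nat_pow_near (x := 20 * L / r) (y := (2 : ℝ))
    (by rw [le_div_iff₀ hr]; linarith) one_lt_two
  set J := n + 1 with hJ
  have hJpos : (0 : ℝ) < 2 ^ J := by positivity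
  have hJ40 : (2 : ℝ) ^ J ≤ 40 * L / r := by
    rw [hJ, pow_succ]
    calc (2 : ℝ) ^ n * 2 ≤ 20 * L / r * 2 := by linarith
      _ = 40 * L / r := by ring
  -- The thickness lies between `r / 40` and `r / 20`, so the bound `6 * e` on coordinate
  -- differences is at most `3 / 10 * r`.
  set e := L / 2 ^ J with he
  have heJ : e * 2 ^ J = L := div_mul_cancel₀ _ hJpos.ne'
  have he0 : 0 < e := div_pos hL0 hJpos
  have he1 : 20 * e ≤ r := by
    rw [div_lt_iff₀ hr] at hn'
    have : 20 * e * 2 ^ J ≤ r * 2 ^ J := by nlinarith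
    exact le_of_mul_le_mul_right this hJpos
  have he2 : r ≤ 40 * e := by
    rw [le_div_iff₀ hr] at hJ40
    have : r * 2 ^ J ≤ 40 * e * 2 ^ J := by nlinarith
    exact le_of_mul_le_mul_right this hJpos
  -- the size of the landing sets
  have hexp : (1 : ℝ) ≤ 2 ^ (1440 * L / r) := Real.one_le_rpow one_le_two (by positivity)
  obtain ⟨μ, hμ, hμ'⟩ := exists_nat_pow_near (x := 99 / 100 * s ^ 2) (y := (2 : ℝ))
    (by linarith) one_lt_two
  -- This is where `1440 = 36 * 40` comes from: `2 ^ J ≤ 40 * L / r`.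
  have hμJ : (30 + 6) * 2 ^ J ≤ μ := by
    have h1 : ((36 * 2 ^ J : ℕ) : ℝ) ≤ 1440 * L / r := by
      push_cast
      calc (36 : ℝ) * 2 ^ J ≤ 36 * (40 * L / r) := by linarith
        _ = 1440 * L / r := by ring
    have h2 : (2 : ℝ) ^ (36 * 2 ^ J + 1) < 2 ^ (μ + 1) := by
      refine lt_of_le_of_lt (le_trans ?_ hbig) hμ'
      rw [pow_succ', ← Real.rpow_natCast]
      exact mul_le_mul_of_nonneg_left (Real.rpow_le_rpow_of_exponent_le one_le_two h1) two_pos.le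
    have := (pow_lt_pow_iff_right₀ one_lt_two).1 h2
    omega
  have hJlog : ∀ g < 2 ^ J, Nat.log 2 g ≤ J := fun g hg => by
    rcases Nat.eq_zero_or_pos g with rfl | h0
    · simp
    · exact (Nat.log_lt_of_lt_pow h0.ne' hg).le
  have hring : ∀ x, ringIndex e (u x) (v x) < 2 ^ J := fun x => by
    refine (Nat.floor_lt' (by positivity)).2 ?_
    push_cast
    rw [div_lt_iff₀ he0, mul_comm, heJ]
    exact max_lt (huL x) (hvL x)
  have hclose : ∀ x y, ringIndex e (u y) (v y) ≤ ringIndex e (u x) (v x) →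
      ringIndex e (u x) (v x) ≤ ringIndex e (u y) (v y) + 1 →
      sectorIndex J (u x) (v x) / 2 ^ (J - Nat.log 2 (ringIndex e (u y) (v y)))
        = sectorIndex J (u y) (v y) / 2 ^ (J - Nat.log 2 (ringIndex e (u y) (v y))) →
      |u x - u y| ≤ 3 / 10 * r ∧ |v x - v y| ≤ 3 / 10 * r := fun x y h1 h2 h3 => by
    rw [sectorIndex_div (hJlog _ (hring y)), sectorIndex_div (hJlog _ (hring y))] at h3
    obtain ⟨h4, h5⟩ := abs_sub_le_of_ringIndex he0 (hu x) (hv x) (hu y) (hv y) h1 h2 h3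
    exact ⟨h4.trans (by linarith), h5.trans (by linarith)⟩
  have hfloor : ∀ (a : ℕ) (t : ℝ), 0 ≤ t →
      (t ∈ Set.Ico (a * s) ((a + 1) * s) ↔ ⌊t / s⌋₊ = a) := fun a t ht => by
    rw [Nat.floor_eq_iff (div_nonneg ht hs.le), le_div_iff₀ hs, div_lt_iff₀ hs, Set.mem_Ico]
  -- A block lies in a box of `12001 × 12001` cells with at most `3 * 2 ^ μ` points each, and `3 *
  -- 12001 ^ 2 < 2 ^ 30`.
  refine totalAcquisition_eq_one_of_rings (J := J) (μ := μ) (k₀ := 30)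
    (ring := fun x => ringIndex e (u x) (v x)) (sec := fun x => sectorIndex J (u x) (v x))
    hring (fun x => sectorIndex_lt (hu x) (v x) J) (fun x y hne h1 h2 h3 => ?_)
    (fun g hg σ hσ => ?_) (fun g hg σ hσ => ?_) hμJ
  · obtain ⟨h4, h5⟩ := hclose x y h1 h2 h3
    exact hadj x y hne h4 h5
  · obtain ⟨u₀, v₀, hu₀, hu₀', hv₀, hv₀', hc⟩ := exists_center_of_block he0 hg hσ
    rw [heJ] at hu₀' hv₀'
    have hidx : ∀ t, 0 < t → t < L → ⌊t / s⌋₊ < ℓ := fun t ht htL => by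
      rw [Nat.floor_lt (div_nonneg ht.le hs.le), div_lt_iff₀ hs, ← hL]; exact htL
    -- Cells have side `s ≤ r / 10000 ≤ e / 250`, so the cell around the middle of a block lies
    -- inside the block.
    have hnear : ∀ t t', 0 < t → t' ∈ Set.Ico (⌊t / s⌋₊ * s) ((⌊t / s⌋₊ + 1) * s) →
        |t' - t| ≤ e / 8 := fun t t' ht ht' => by
      have h1 := (hfloor _ t ht.le).2 rfl
      rw [Set.mem_Ico] at h1 ht'
      rw [abs_le]; constructor <;> linarith [h1.1, h1.2, ht'.1, ht'.2]
    have h1 := hlo _ (hidx u₀ hu₀ hu₀') _ (hidx v₀ hv₀ hv₀')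
    have h2 : ((2 ^ μ : ℕ) : ℝ) ≤ 99 / 100 * s ^ 2 := by
      push_cast
      exact hμ
    refine (Nat.cast_le.1 (h2.trans h1)).trans (Set.ncard_le_ncard (fun x hx => ?_) (Set.toFinite _))
    obtain ⟨h3, h4⟩ := hc (u x) (v x) (hu x) (hv x) (hnear _ _ hu₀ hx.1) (hnear _ _ hv₀ hx.2)
    refine ⟨h3, ?_⟩
    rw [sectorIndex_div (hJlog g hg)]
    exact h4
  · set D : Finset V :=
      {x | ringIndex e (u x) (v x) = g ∧ sectorIndex J (u x) (v x) / 2 ^ (J - Nat.log 2 g) = σ}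
      with hD
    have hDc : {x | ringIndex e (u x) (v x) = g ∧
        sectorIndex J (u x) (v x) / 2 ^ (J - Nat.log 2 g) = σ}.ncard = #D := by
      rw [← Set.ncard_coe_finset]; congr 1; ext x; simp [hD]
    rw [hDc]
    rcases D.eq_empty_or_nonempty with h0 | ⟨y, hy⟩
    · simp [h0]
    have hcell : ∀ a b : ℕ, #{x | ⌊u x / s⌋₊ = a ∧ ⌊v x / s⌋₊ = b} ≤ ⌊101 / 100 * s ^ 2⌋₊ := by
      intro a b
      by_cases hab : a < ℓ ∧ b < ℓ
      · refine Nat.le_floor (le_of_eq_of_le ?_ (hhi a hab.1 b hab.2))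
        rw [← Set.ncard_coe_finset]
        congr 2
        ext x
        simp only [coe_filter, mem_univ, true_and, Set.mem_ofPred_eq, hfloor _ _ (hu x).le,
          hfloor _ _ (hv x).le]
      · rw [Finset.filter_false_of_mem, card_empty]
        · exact Nat.zero_le _
        · rintro x - ⟨rfl, rfl⟩
          refine hab ⟨?_, ?_⟩
          · rw [Nat.floor_lt (div_nonneg (hu x).le hs.le), div_lt_iff₀ hs, ← hL]; exact huL x
          · rw [Nat.floor_lt (div_nonneg (hv x).le hs.le), div_lt_iff₀ hs, ← hL]; exact hvL x
    have hclose' : ∀ x ∈ D, |u x - u y| ≤ 3 / 10 * r ∧ |v x - v y| ≤ 3 / 10 * r := fun x hx => by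
      rw [hD, mem_filter] at hx hy
      refine hclose x y (by rw [hx.2.1, hy.2.1]) (by rw [hx.2.1, hy.2.1]; omega) ?_
      rw [hy.2.1, hx.2.2, hy.2.2]
    -- `3 / 10 * r ≤ 3 / 10 * 20000 * s = 6000 * s`.
    have hdiv : ∀ t t' : ℝ, |t - t'| ≤ 3 / 10 * r → |t / s - t' / s| ≤ (6000 : ℕ) := by
      intro t t' h
      rw [← sub_div, abs_div, abs_of_pos hs, div_le_iff₀ hs]
      push_cast
      linarith
    have hbox : ∀ t t' : ℝ, 0 < t → 0 < t' → |t - t'| ≤ 3 / 10 * r →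
        ⌊t' / s⌋₊ ≤ ⌊t / s⌋₊ + 6000 ∧ ⌊t / s⌋₊ ≤ ⌊t' / s⌋₊ + 6000 := fun t t' ht ht' h =>
      ⟨floor_le_floor_add (div_nonneg ht.le hs.le) (hdiv _ _ h),
        floor_le_floor_add (div_nonneg ht'.le hs.le) (hdiv _ _ (by rwa [abs_sub_comm]))⟩
    have hcard := card_le_of_cells D hcell
      (fun x hx => hbox _ _ (hu x) (hu y) (hclose' x hx).1)
      (fun x hx => hbox _ _ (hv x) (hv y) (hclose' x hx).2)
    have hfl : (⌊101 / 100 * s ^ 2⌋₊ : ℝ) ≤ 101 / 100 * s ^ 2 := Nat.floor_le (by positivity)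
    -- By maximality of `μ`, `99 / 100 * s ^ 2 < 2 * 2 ^ μ`, and `2 * 101 / 99 < 3`.
    have : (⌊101 / 100 * s ^ 2⌋₊ : ℝ) ≤ ((3 * 2 ^ μ : ℕ) : ℝ) := by
      push_cast
      rw [pow_succ (2 : ℝ) μ] at hμ'
      have : (0 : ℝ) < 2 ^ μ := by positivity
      linarith
    have h3 : ⌊101 / 100 * s ^ 2⌋₊ ≤ 3 * 2 ^ μ := Nat.cast_le.1 this
    refine hcard.trans ((Nat.mul_le_mul_right _ h3).trans ?_)
    rw [pow_add]
    have := Nat.zero_le (2 ^ μ)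
    omega

/-! ### Numerical parameters and the passage to the given squares -/

theorem le_lg_of_two_pow_le {r : ℝ} {m : ℕ} (hr : (2 : ℝ) ^ m ≤ r) : (m : ℝ) ≤ lg r := by
  rw [lg, Real.le_logb_iff_rpow_le one_lt_two (lt_of_lt_of_le (by positivity) hr)]
  exact_mod_cast hr

/-- The parameters of the tessellations for large `r`. -/
theorem tessellation_bounds {r : ℝ} {n : ℕ} (hr0 : 0 < r) (hlg : 1000 ≤ lg r)
    (hn : r * lg r ≤ √(n : ℝ)) :
    largeSide (1 / 10000) r n
      = numSmall (1 / 10000) r n * smallSide (1 / 10000) r n ∧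
    r ≤ 20000 * smallSide (1 / 10000) r n ∧ 10000 * smallSide (1 / 10000) r n ≤ r ∧
    r ≤ 20 * largeSide (1 / 10000) r n ∧
    10000 * largeSide (1 / 10000) r n ≤ r * lg r := by
  have hlg0 : 0 < lg r := by linarith
  have hrl : 0 < r * lg r := mul_pos hr0 hlg0
  set A := √(n : ℝ) / (r * lg r) with hA
  have hA1 : 1 ≤ A := (one_le_div hrl).2 hn
  have hk : numLarge (1 / 10000) r n = ⌈10000 * A⌉₊ := by
    rw [numLarge, hA]; congr 1; field_simp
  have hk1 : 10000 * A ≤ numLarge (1 / 10000) r n := hk ▸ Nat.le_ceil _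
  have hk2 : (numLarge (1 / 10000) r n : ℝ) < 10000 * A + 1 :=
    hk ▸ Nat.ceil_lt_add_one (by positivity)
  have hk0 : (0 : ℝ) < numLarge (1 / 10000) r n := by linarith
  set x := xRatio (1 / 10000) r n with hx
  have hxe : x * numLarge (1 / 10000) r n = A := by
    rw [hx, xRatio, hA]; field_simp
  have hx0 : 0 < x := by
    by_contra h
    nlinarith
  have hx1 : 10000 * x ≤ 1 := by
    by_contra h
    nlinarith
  -- As `A ≥ 1`, rounding up `10000 * A` at most doubles it.
  have hx2 : 1 ≤ 20000 * x := by
    by_contra h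
    nlinarith
  have ht : 0 < x * lg r := mul_pos hx0 hlg0
  -- So `x * lg r ≥ 1 / 20`, which gives `r ≤ 20 * L` and makes the rounding error `20` in the
  -- number of small squares harmless.
  have ht1 : 1000 ≤ 20000 * (x * lg r) := by nlinarith
  set m := ⌈x * lg r / (20 * (1 / 10000))⌉₊ with hm
  have hℓ : (numSmall (1 / 10000) r n : ℝ) = 20 * m := by
    rw [numSmall]; push_cast; rfl
  have hm1 : x * lg r / (20 * (1 / 10000)) ≤ m := Nat.le_ceil _
  have hm2 : (m : ℝ) < x * lg r / (20 * (1 / 10000)) + 1 := Nat.ceil_lt_add_one (by positivity)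
  rw [show x * lg r / (20 * (1 / 10000)) = 500 * (x * lg r) by ring] at hm1 hm2
  have hm1' : 10000 * (x * lg r) ≤ 20 * m := by linarith
  have hm2' : 20 * (m : ℝ) < 10000 * (x * lg r) + 20 := by linarith
  have hℓ0 : (0 : ℝ) < numSmall (1 / 10000) r n := by rw [hℓ]; linarith
  set y := yRatio (1 / 10000) r n with hy
  have hye : numSmall (1 / 10000) r n * y = x * lg r := by
    rw [hy, yRatio]; field_simp; rfl
  have hy1 : 10000 * y ≤ 1 := by
    rw [hℓ] at hye hℓ0
    by_contra h
    nlinarith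
  have hy2 : 1 ≤ 20000 * y := by
    rw [hℓ] at hye hℓ0
    by_contra h
    nlinarith
  have hs : smallSide (1 / 10000) r n = y * r := rfl
  have hL : largeSide (1 / 10000) r n = x * r * lg r := rfl
  rw [hs, hL]
  refine ⟨?_, by nlinarith, by nlinarith, by nlinarith, by nlinarith⟩
  rw [← mul_assoc, hye]; ring

/-- The exponent is at most `lg r`, so the left side is at most `2 * r`, whereas `s ^ 2` is at least
`r ^ 2 / (4 * 10 ^ 8)`. -/
theorem two_mul_rpow_le {r L s : ℝ} (hr : (2 : ℝ) ^ 34 ≤ r) (hs : r ≤ 20000 * s)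
    (hL : 10000 * L ≤ r * lg r) : 2 * (2 : ℝ) ^ (1440 * L / r) ≤ 99 / 100 * s ^ 2 := by
  have hr0 : 0 < r := lt_of_lt_of_le (by positivity) hr
  have hlg : 0 ≤ lg r := Real.logb_nonneg one_lt_two (le_trans (by norm_num) hr)
  have h1 : 1440 * L / r ≤ lg r := by
    rw [div_le_iff₀ hr0]
    nlinarith [mul_nonneg hr0.le hlg]
  have h2 : (2 : ℝ) ^ (1440 * L / r) ≤ r :=
    (Real.rpow_le_rpow_of_exponent_le one_le_two h1).trans_eq
      (Real.rpow_logb two_pos (by norm_num) hr0)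
  have h3 : r * r ≤ 20000 * s * (20000 * s) := mul_le_mul hs hs hr0.le (by linarith)
  nlinarith

theorem dist_le_of_abs_sub_le {p q : Plane} {r : ℝ} (h₀ : |p 0 - q 0| ≤ 3 / 10 * r)
    (h₁ : |p 1 - q 1| ≤ 3 / 10 * r) : dist p q ≤ r := by
  have hr : 0 ≤ r := by linarith [abs_nonneg (p 0 - q 0)]
  rw [EuclideanSpace.dist_eq, Fin.sum_univ_two, Real.dist_eq, Real.dist_eq]
  refine Real.sqrt_le_iff.2 ⟨hr, ?_⟩
  nlinarith [abs_nonneg (p 0 - q 0), abs_nonneg (p 1 - q 1)]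

/-- The cells of a large square, in coordinates relative to its lower left corner. -/
theorem ncard_inter_smallSquare {X : Set Plane} {c r : ℝ} {n i j a b : ℕ}
    (hL : largeSide c r n = numSmall c r n * smallSide c r n) (hs : 0 < smallSide c r n)
    (ha : a < numSmall c r n) (hb : b < numSmall c r n) :
    {x : ↥(X ∩ largeSquare c r n i j) |
      (x : Plane) 0 - i * largeSide c r n ∈ Set.Ico (a * smallSide c r n)
        ((a + 1) * smallSide c r n) ∧
      (x : Plane) 1 - j * largeSide c r n ∈ Set.Ico (b * smallSide c r n)
        ((b + 1) * smallSide c r n)}.ncard = (X ∩ smallSquare c r n i j a b).ncard := by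
  rw [← Set.ncard_image_of_injective _ Subtype.val_injective]
  congr 1
  have ha' : ((a : ℝ) + 1) * smallSide c r n ≤ largeSide c r n := by
    rw [hL]; exact mul_le_mul_of_nonneg_right (by exact_mod_cast ha) hs.le
  have hb' : ((b : ℝ) + 1) * smallSide c r n ≤ largeSide c r n := by
    rw [hL]; exact mul_le_mul_of_nonneg_right (by exact_mod_cast hb) hs.le
  have ha0 : 0 ≤ (a : ℝ) * smallSide c r n := by positivity
  have hb0 : 0 ≤ (b : ℝ) * smallSide c r n := by positivity
  ext p
  simp only [Set.mem_image, Set.mem_ofPred_eq, Subtype.exists, Set.mem_inter_iff, smallSquare,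
    Set.mem_Ico]
  constructor
  · rintro ⟨q, ⟨hq, -⟩, ⟨⟨h1, h2⟩, h3, h4⟩, rfl⟩
    exact ⟨hq, ⟨by linarith, by linarith⟩, by linarith, by linarith⟩
  · rintro ⟨hp, ⟨h1, h2⟩, h3, h4⟩
    refine ⟨p, ⟨hp, ⟨by linarith, by linarith⟩, by linarith, by linarith⟩,
      ⟨⟨by linarith, by linarith⟩, by linarith, by linarith⟩, rfl⟩

/-- Points of a good large square lie in its interior. -/
theorem IsGoodLarge.mem_interior {c ε r : ℝ} {n i j : ℕ} {X : Set Plane}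
    (h : IsGoodLarge c ε r n X i j) (x : ↥(X ∩ largeSquare c r n i j)) :
    (0 < (x : Plane) 0 - i * largeSide c r n ∧
      (x : Plane) 0 - i * largeSide c r n < largeSide c r n) ∧
    0 < (x : Plane) 1 - j * largeSide c r n ∧
      (x : Plane) 1 - j * largeSide c r n < largeSide c r n := by
  have hb := (h.off_border x x.2).1
  have hx := x.2.2
  obtain ⟨⟨h1, h2⟩, h3, h4⟩ := hx
  have h1 := lt_of_le_of_ne' h1 fun h' => hb ⟨x.2.2, .inl h'⟩
  have h2 := lt_of_le_of_ne h2 fun h' => hb ⟨x.2.2, .inr (.inl h')⟩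
  have h3 := lt_of_le_of_ne' h3 fun h' => hb ⟨x.2.2, .inr (.inr (.inl h'))⟩
  have h4 := lt_of_le_of_ne h4 fun h' => hb ⟨x.2.2, .inr (.inr (.inr h'))⟩
  exact ⟨⟨by linarith, by linarith⟩, by linarith, by linarith⟩

end Acquisition

theorem theorem3p4 :
    ∃ C : ℝ, ∀ (n : ℕ) (r : ℝ), C ≤ r → r * Acquisition.lg r ≤ √(n : ℝ) →
      ∀ X : Set Acquisition.Plane, X.Finite →
      ∀ i < Acquisition.numLarge (1 / 10000) r n, ∀ j < Acquisition.numLarge (1 / 10000) r n,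
        Acquisition.IsGoodLarge (1 / 10000) (1 / 100) r n X i j →
        Acquisition.totalAcquisition
          (Acquisition.geometricGraph (X ∩ Acquisition.largeSquare (1 / 10000) r n i j) r) = 1 := by
  -- The constant is chosen so that `lg r ≥ 1000`, as `tessellation_bounds` requires.
  refine ⟨2 ^ 1000, fun n r hr hn X hX i _ j _ hgood => ?_⟩
  have hr0 : 0 < r := lt_of_lt_of_le (by positivity) hr
  have hr1 : (2 : ℝ) ^ 34 ≤ r := (pow_le_pow_right₀ one_le_two (by norm_num)).trans hr
  have hlg : 1000 ≤ Acquisition.lg r := by exact_mod_cast Acquisition.le_lg_of_two_pow_le hr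
  clear hr
  obtain ⟨hL, hs₁, hs₂, hLr, hL'⟩ := Acquisition.tessellation_bounds hr0 hlg hn
  have hs : 0 < Acquisition.smallSide (1 / 10000) r n := by linarith
  have : Finite ↥(X ∩ Acquisition.largeSquare (1 / 10000) r n i j) :=
    (hX.subset Set.inter_subset_left).to_subtype
  refine Acquisition.totalAcquisition_eq_one_of_cells
    (u := fun x => (x : Acquisition.Plane) 0 - i * Acquisition.largeSide (1 / 10000) r n)
    (v := fun x => (x : Acquisition.Plane) 1 - j * Acquisition.largeSide (1 / 10000) r n)
    hr0 (fun x => (hgood.mem_interior x).1.1) (fun x => (hgood.mem_interior x).1.2)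
    (fun x => (hgood.mem_interior x).2.1) (fun x => (hgood.mem_interior x).2.2)
    (fun x y hne h0 h1 => ⟨hne, Acquisition.dist_le_of_abs_sub_le ?_ ?_⟩)
    hL hs₁ hs₂ hLr (fun a ha b hb => ?_) (fun a ha b hb => ?_)
    (Acquisition.two_mul_rpow_le hr1 hs₁ hL')
  · rwa [sub_sub_sub_cancel_right] at h0
  · rwa [sub_sub_sub_cancel_right] at h1
  · rw [Acquisition.ncard_inter_smallSquare hL hs ha hb]
    refine le_of_eq_of_le ?_ (hgood.small a ha b hb).1
    rw [Acquisition.smallSide]; norm_num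
  · rw [Acquisition.ncard_inter_smallSquare hL hs ha hb]
    refine (hgood.small a ha b hb).2.trans_eq ?_
    rw [Acquisition.smallSide]; norm_num
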